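/- **Gain graphs.** Let $G$ be a group. A gain graph $\Gamma$ with gain group $G$ consists of a finite vertex set $V_\Gamma$, a set $L_\Gamma\subseteq V_\Gamma$ of loops, and a finite set $E_\Gamma$ of edges $\{u,v\}_g$ with $u\ne v$ in $V_\Gamma$ and $g\in G$, where $\{u,v\}_g=\{v,u\}_{g^{-1}}$. It is loopless if $L_\Gamma=\varnothing$, and connected if any two vertices are joined by a path of edges. For $W\subseteq V_\Gamma$, the induced subgraph $\Gamma[W]$ has vertex set $W$, loop set $W\cap L_\Gamma$, and all edges $\{u,v\}_g\in E_\Gamma$ with $u,v\in W$; and $\Gamma\setminus v:=\Gamma[V_\Gamma\setminus\{v\}]$. Isomorphism means relabelling of the vertices. For a finite subgroup $H\subseteq G$, $K_n^{H}$ is the loopless gain graph on $\{1,\dots,n\}$ with all edges $\{i,j\}_g$, $i\neq j$, $g\in H$. For finite $G$, $\mathring K_n^{G}$ is $K_n^G$ with a loop added at every vertex (for $n=0$ this is the null graph, which has no vertices). A vertex $v$ of $\Gamma$ is *bias simplicial* if (a) $\{u,v\}_g,\{v,w\}_h\in E_\Gamma$ with $u\neq w$ implies $\{u,w\}_{gh}\in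 E_\Gamma$; (b) $\{u,v\}_g,\{u,v\}_h\in E_\Gamma$ with $g\ne h$ implies $u\in L_\Gamma$; (c) $\{u,v\}_g\in E_\Gamma$ and $v\in L_\Gamma$ imply $u\in L_\Gamma$. A simple graph is *chordal* if every cycle of length at least $4$ has a chord. **Arrangements.** A central arrangement $\mathcal A$ in a finite-dimensional vector space is a finite set of subspaces of codimension $1$. Its matroid $M(\mathcal A)$ has ground set $\mathcal A$, a subset being independent if the codimension of its intersection equals its cardinality. For a matroid $M$ on a finite ground set with rank function $r$, put $\chi(M,t)=\sum_{X}\mu(X)\,t^{r(M)-r(X)}$, the sum being over all flats $X$, where $\mu(X)$ is the value of the Möbius function of the lattice of flats on the interval from its least element to $X$. A *divisional flag* of a simple matroid $M$ of rank $n$ on $E$ is a chain of flats $\varnothing=X_0\subseteq X_1\subseteq\dots\subseteq X_n=E$ with $r(X_i)=i$ for $0\le i\le n$ and such that $\chi(M/X_{i+1},t)$ divides $\chi(M/X_i,t)$ in $\mathbb Z[t]$ for $0\le i<n$. The arrangement $\mathcal A$ is *divisionally free* if $M(\mathcal A)$ has a divisional flag. If $G$ is a finite subgroup of the multiplicative group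 $\mathbb K^\times$ of a field $\mathbb K$ and $\Gamma$ is a gain graph with gain group $G$, then $\mathcal A_\times(\Gamma)$ is the arrangement in $\mathbb K^{V_\Gamma}$ consisting of the hyperplanes $\{x_u-g x_v=0\}$ for $\{u,v\}_g\in E_\Gamma$ and $\{x_u=0\}$ for $u\in L_\Gamma$. **Theorem.** Let $G$ be a finite subgroup of the multiplicative group of a field $\mathbb K$, and let $\mathcal C^G_\times$ be the smallest class of gain graphs with gain group $G$, closed under isomorphism, that satisfies the following conditions. 1. The null graph belongs to $\mathcal C^G_\times$. 2. $K_2^G\in\mathcal C^G_\times$. 3. If $\{\pm1\}\subseteq G$, then $K_3^{\{\pm1\}}\in\mathcal C^G_\times$. 4. If $\{\pm1\}\subseteq G$, then $\mathcal C^G_\times$ contains every connected loopless gain graph with all gains in $\{\pm1\}$ such that the positive edges (those of gain $1$) form a chordal graph, the negative edges (those of gain $-1$) form a star $\{u,v_1\}_{-1},\dots,\{u,v_r\}_{-1}$, and any two distinct vertices among $v_1,\dots,v_r$ are joined by a positive edge. 5. If $\Gamma$ has a bias-simplicial vertex $v$ and $\Gamma\setminus v\in\mathcal C^G_\times$, then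 $\Gamma\in\mathcal C^G_\times$. 6. If $V_\Gamma=V_1\cup V_2$ with $\Gamma[V_1],\Gamma[V_2]\in\mathcal C^G_\times$, $E_\Gamma=E_{\Gamma[V_1]}\cup E_{\Gamma[V_2]}$, and $\Gamma[V_1\cap V_2]\simeq\mathring K_n^G$ for some $n\ge0$, then $\Gamma\in\mathcal C^G_\times$. Then for every $\Gamma\in\mathcal C^G_\times$ the arrangement $\mathcal A_\times(\Gamma)$ is divisionally free. -/

import Mathlib

universe u v w

/-! ### Gain graphs -/

/-- A gain graph on the vertex set `V` with gain group `G`.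
`Γ.Edge u v g` says that `{u,v}_g` is an edge; the identification `{u,v}_g = {v,u}_{g⁻¹}`
is the field `symm`. The set of loops is a set of vertices. (The vertex sets and gain groups
used below are finite, so that there are only finitely many edges.) -/
@[ext]
structure GainGraph (V : Type u) (G : Type v) [Group G] where
  Edge : V → V → G → Prop
  symm : ∀ {u v : V} {g : G}, Edge u v g → Edge v u g⁻¹
  irrefl : ∀ (u : V) (g : G), ¬ Edge u u g
  Loops : Set V

namespace GainGraph

variable {V : Type u} {W : Type w} {G : Type v} [Group G]

/-- The induced subgraph `Γ[S]`. -/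
def induce (Γ : GainGraph V G) (S : Set V) : GainGraph S G where
  Edge a b g := Γ.Edge a b g
  symm h := Γ.symm h
  irrefl a g := Γ.irrefl a g
  Loops := {a | (a : V) ∈ Γ.Loops}

/-- Isomorphism of gain graphs with the same gain group: a relabelling of the vertices. -/
def IsIso (Γ : GainGraph V G) (Δ : GainGraph W G) : Prop :=
  ∃ φ : V ≃ W, (∀ a b g, Γ.Edge a b g ↔ Δ.Edge (φ a) (φ b) g) ∧
    ∀ a, a ∈ Γ.Loops ↔ φ a ∈ Δ.Loops

/-- `K_n^H`, for a subgroup `H` of the gain group, as a gain graph with gain group `G`. -/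
def complete (n : ℕ) (H : Subgroup G) : GainGraph (Fin n) G where
  Edge i j g := i ≠ j ∧ g ∈ H
  symm h := ⟨h.1.symm, H.inv_mem h.2⟩
  irrefl _ _ h := h.1 rfl
  Loops := ∅

/-- `K_n^G` together with all possible loops. -/
def completeWithLoops (n : ℕ) (G : Type v) [Group G] : GainGraph (Fin n) G where
  Edge i j _ := i ≠ j
  symm h := h.symm
  irrefl _ _ h := h rfl
  Loops := Set.univ

/-- Bias-simplicial vertices. -/
structure IsBiasSimplicial (Γ : GainGraph V G) (v : V) : Prop where
  triangle : ∀ {u w : V} {g h : G}, u ≠ w → Γ.Edge u v g → Γ.Edge v w h → Γ.Edge u w (g * h)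
  parallel : ∀ {u : V} {g h : G}, Γ.Edge u v g → Γ.Edge u v h → g ≠ h → u ∈ Γ.Loops
  loop : ∀ {u : V} {g : G}, Γ.Edge u v g → v ∈ Γ.Loops → u ∈ Γ.Loops

/-- The underlying simple graph: two distinct vertices are adjacent if some edge joins them. -/
def underlying (Γ : GainGraph V G) : SimpleGraph V where
  Adj a b := ∃ g, Γ.Edge a b g
  symm := ⟨fun _ _ ⟨g, h⟩ => ⟨g⁻¹, Γ.symm h⟩⟩
  loopless := ⟨fun a ⟨g, h⟩ => Γ.irrefl a g h⟩

/-- The simple graph formed by the edges with trivial gain. -/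
def positivePart (Γ : GainGraph V G) : SimpleGraph V where
  Adj a b := Γ.Edge a b 1
  symm := ⟨fun _ _ h => by simpa using Γ.symm h⟩
  loopless := ⟨fun a h => Γ.irrefl a 1 h⟩

end GainGraph

/-- A simple graph is chordal if every cycle of length at least four has a chord: an edge that joins
two vertices of the cycle and is not an edge of the cycle. -/
def SimpleGraph.IsChordalGraph {V : Type u} (G : SimpleGraph V) : Prop :=
  ∀ (a : V) (p : G.Walk a a), p.IsCycle → 4 ≤ p.length →
    ∃ x ∈ p.support, ∃ y ∈ p.support, G.Adj x y ∧ s(x, y) ∉ p.edges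

/-- The subgroup `{1, -1}` of the multiplicative group of a field. -/
def signSubgroup (K : Type v) [Field K] : Subgroup Kˣ where
  carrier := {1, -1}
  one_mem' := by simp
  mul_mem' := by
    rintro a b (rfl | rfl) (rfl | rfl) <;> simp
  inv_mem' := by
    rintro a (rfl | rfl) <;> simp

/-- Let `G` be a subgroup of `Kˣ` containing `-1`. The connected loopless gain graphs `Γ`
with gains in `{1, -1}` whose positive edges form a chordal graph and whose negative edges are
`{c, s}_{-1}` for `s` in a set `S` of vertices different from `c`, where any two distinct
elements of `S` are joined by a positive edge. -/
structure GainGraph.IsChordalWithNegativeStar {V : Type u} {K : Type v} [Field K]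
    {G : Subgroup Kˣ} (hG : signSubgroup K ≤ G) (Γ : GainGraph V G) : Prop where
  connected : Γ.underlying.Connected
  loopless : Γ.Loops = ∅
  gain_mem : ∀ a b (g : G), Γ.Edge a b g → (g : Kˣ) ∈ signSubgroup K
  chordal : Γ.positivePart.IsChordalGraph
  star : ∃ (c : V) (S : Set V), c ∉ S ∧
    (∀ a b, Γ.Edge a b ⟨-1, hG (Or.inr rfl)⟩ ↔ (a = c ∧ b ∈ S) ∨ (b = c ∧ a ∈ S)) ∧
    ∀ a ∈ S, ∀ b ∈ S, a ≠ b → Γ.Edge a b 1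

/-- The smallest class of finite gain graphs with gain group `G ≤ Kˣ` that satisfies the six listed
conditions. Being an inductive predicate makes it the smallest such class. -/
inductive FrameClass {K : Type v} [Field K] (G : Subgroup Kˣ) :
    ∀ {V : Type u} [Finite V], GainGraph V G → Prop
  | null {V : Type u} [Finite V] [IsEmpty V] (Γ : GainGraph V G) : FrameClass G Γ
  | completeTwo {V : Type u} [Finite V] (Γ : GainGraph V G)
      (h : Γ.IsIso (GainGraph.complete 2 (⊤ : Subgroup G))) : FrameClass G Γ
  | signedCompleteThree {V : Type u} [Finite V] (_ : signSubgroup K ≤ G) (Γ : GainGraph V G)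
      (h : Γ.IsIso (GainGraph.complete 3 ((signSubgroup K).subgroupOf G))) : FrameClass G Γ
  | chordalWithNegativeStar {V : Type u} [Finite V] (hG : signSubgroup K ≤ G)
      (Γ : GainGraph V G) (h : Γ.IsChordalWithNegativeStar hG) : FrameClass G Γ
  | biasSimplicial {V : Type u} [Finite V] (Γ : GainGraph V G) (v : V)
      (hv : Γ.IsBiasSimplicial v) (h : FrameClass G (Γ.induce {v}ᶜ)) : FrameClass G Γ
  | glue {V : Type u} [Finite V] (Γ : GainGraph V G) (V₁ V₂ : Set V) (n : ℕ)
      (hV : V₁ ∪ V₂ = Set.univ)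
      (h₁ : FrameClass G (Γ.induce V₁)) (h₂ : FrameClass G (Γ.induce V₂))
      (hE : ∀ a b g, Γ.Edge a b g → (a ∈ V₁ ∧ b ∈ V₁) ∨ (a ∈ V₂ ∧ b ∈ V₂))
      (hn : (Γ.induce (V₁ ∩ V₂)).IsIso (GainGraph.completeWithLoops n G)) : FrameClass G Γ

/-! ### Characteristic polynomials and divisional flags of matroids -/

namespace Matroid

variable {α : Type u}

/-- The flats of `M`, ordered by inclusion. -/
abbrev FlatType (M : Matroid α) : Type u := {F : Set α // M.IsFlat F}

instance finite_flatType (M : Matroid α) [M.Finite] : Finite M.FlatType :=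
  (M.ground_finite.finite_subsets.subset fun _ hF => hF.subset_ground).to_subtype

/-- The rank of a subset, as a natural number. -/
noncomputable def natRk (M : Matroid α) (X : Set α) : ℕ := (M.eRk X).toNat

/-- The value `μ(F)` at the flat `F` of the one-variable Möbius function of the lattice of flats. -/
noncomputable def flatMoebius (M : Matroid α) [M.Finite] (F : M.FlatType) : ℤ :=
  letI := Fintype.ofFinite M.FlatType
  letI := Classical.decEq M.FlatType
  letI : DecidableLE M.FlatType := Classical.decRel _
  letI : DecidableLT M.FlatType := Classical.decRel _
  letI : LocallyFiniteOrder M.FlatType := Fintype.toLocallyFiniteOrder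
  IncidenceAlgebra.mu ℤ (⟨M.closure ∅, M.isFlat_closure ∅⟩ : M.FlatType) F

/-- The characteristic polynomial `χ(M, t) = ∑_F μ(F) t^{r(M) - r(F)}`, over all flats `F`. -/
noncomputable def charPoly (M : Matroid α) [M.Finite] : Polynomial ℤ :=
  letI := Fintype.ofFinite M.FlatType
  ∑ F : M.FlatType,
    Polynomial.C (M.flatMoebius F) * Polynomial.X ^ (M.natRk M.E - M.natRk F.1)

/-- `M` has a divisional flag `∅ = X₀ ⊆ X₁ ⊆ ⋯ ⊆ Xₙ = E`, where `n` is the rank of `M`. -/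
def HasDivisionalFlag (M : Matroid α) [M.Finite] : Prop :=
  ∃ X : ℕ → Set α,
    X 0 = ∅ ∧ X (M.natRk M.E) = M.E ∧
    (∀ i ≤ M.natRk M.E, M.IsFlat (X i) ∧ M.natRk (X i) = i) ∧
    ∀ i < M.natRk M.E, X i ⊆ X (i + 1) ∧ (M ／ X (i + 1)).charPoly ∣ (M ／ X i).charPoly

end Matroid

/-! ### Hyperplane arrangements -/

section Arrangement

variable {K : Type v} [Field K] {E : Type u} [AddCommGroup E] [Module K E]

/-- The codimension of a subspace. -/
noncomputable def Submodule.codim (P : Submodule K E) : ℕ := Module.finrank K (E ⧸ P)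

variable (K E) in
/-- A central hyperplane arrangement: a finite set of subspaces of codimension one. -/
structure HyperplaneArrangement where
  hyperplanes : Set (Submodule K E)
  finite : hyperplanes.Finite
  codim_eq_one : ∀ H ∈ hyperplanes, H.codim = 1

variable [FiniteDimensional K E]

theorem Submodule.codim_add_finrank (P : Submodule K E) :
    P.codim + Module.finrank K P = Module.finrank K E :=
  P.finrank_quotient_add_finrank

theorem Submodule.codim_anti {P Q : Submodule K E} (h : P ≤ Q) : Q.codim ≤ P.codim := by
  have := P.codim_add_finrank
  have := Q.codim_add_finrank
  have := Submodule.finrank_mono h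
  omega

theorem Submodule.codim_strictAnti {P Q : Submodule K E} (h : P < Q) : Q.codim < P.codim := by
  have := P.codim_add_finrank
  have := Q.codim_add_finrank
  have := Submodule.finrank_lt_finrank_of_lt h
  omega

theorem Submodule.codim_inf_le (P Q : Submodule K E) : (P ⊓ Q).codim ≤ P.codim + Q.codim := by
  have := P.codim_add_finrank
  have := Q.codim_add_finrank
  have := (P ⊓ Q).codim_add_finrank
  have := Submodule.finrank_sup_add_finrank_inf_eq P Q
  have := Submodule.finrank_le (P ⊔ Q)
  omega

namespace HyperplaneArrangement

theorem codim_sInf_union_le (A : HyperplaneArrangement K E) (I J : Set (Submodule K E))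
    (hJ : J ⊆ A.hyperplanes) : (sInf (I ∪ J)).codim ≤ (sInf I).codim + J.ncard := by
  have hfin : J.Finite := A.finite.subset hJ
  induction J, hfin using Set.Finite.induction_on with
  | empty => simp
  | @insert H J hH hfin ih =>
    have h1 := ih ((Set.subset_insert _ _).trans hJ)
    have h2 := A.codim_eq_one H (hJ (Set.mem_insert _ _))
    rw [Set.union_insert, sInf_insert, Set.ncard_insert_of_notMem hH hfin]
    have h3 := Submodule.codim_inf_le H (sInf (I ∪ J))
    omega

theorem codim_sInf_le (A : HyperplaneArrangement K E) (J : Set (Submodule K E))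
    (hJ : J ⊆ A.hyperplanes) : (sInf J).codim ≤ J.ncard := by
  have h := A.codim_sInf_union_le ∅ J hJ
  have h0 := (⊤ : Submodule K E).codim_add_finrank
  rw [finrank_top] at h0
  rw [Set.empty_union, sInf_empty] at h
  omega

/-- The linear dependence matroid `M(A)` on the set of hyperplanes of `A`: a set of hyperplanes is
independent if the codimension of its intersection equals its cardinality. -/
noncomputable def matroid (A : HyperplaneArrangement K E) : Matroid (Submodule K E) :=
  (IndepMatroid.ofFinite A.finite
    (fun B => B ⊆ A.hyperplanes ∧ (sInf B).codim = B.ncard)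
    (by
      refine ⟨Set.empty_subset _, ?_⟩
      have h0 := (⊤ : Submodule K E).codim_add_finrank
      rw [finrank_top] at h0
      rw [sInf_empty, Set.ncard_empty]
      omega)
    (by
      rintro I J ⟨hJ, hc⟩ hIJ
      refine ⟨hIJ.trans hJ, le_antisymm (A.codim_sInf_le I (hIJ.trans hJ)) ?_⟩
      have h1 := A.codim_sInf_union_le I (J \ I) (Set.sdiff_subset.trans hJ)
      rw [Set.union_sdiff_cancel hIJ] at h1
      have h2 := Set.ncard_sdiff_add_ncard_of_subset hIJ (A.finite.subset hJ)
      omega)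
    (by
      rintro I J ⟨hI, hcI⟩ ⟨hJ, hcJ⟩ hlt
      have hex : ∃ H ∈ J, ¬ sInf I ≤ H := by
        by_contra! hcon
        have := Submodule.codim_anti (le_sInf hcon)
        omega
      obtain ⟨H, hHJ, hH⟩ := hex
      have hHI : H ∉ I := fun h => hH (sInf_le h)
      refine ⟨H, hHJ, hHI, Set.insert_subset (hJ hHJ) hI, ?_⟩
      apply le_antisymm (A.codim_sInf_le _ (Set.insert_subset (hJ hHJ) hI))
      rw [Set.ncard_insert_of_notMem hHI (A.finite.subset hI), sInf_insert]
      have := Submodule.codim_strictAnti (inf_lt_right.2 hH)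
      omega)
    (fun _ h => h.1)).matroid

instance finite_matroid (A : HyperplaneArrangement K E) : A.matroid.Finite := ⟨A.finite⟩

/-- `A` is divisionally free if `M(A)` has a divisional flag. -/
def IsDivisionallyFree (A : HyperplaneArrangement K E) : Prop := A.matroid.HasDivisionalFlag

end HyperplaneArrangement

theorem LinearMap.codim_ker_eq_one (φ : E →ₗ[K] K) (h : φ ≠ 0) :
    (LinearMap.ker φ).codim = 1 := by
  have h1 := (LinearMap.ker φ).codim_add_finrank
  have h2 := LinearMap.finrank_range_add_finrank_ker φ
  rw [LinearMap.range_eq_top.2 (LinearMap.surjective h), finrank_top, Module.finrank_self] at h2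
  omega

end Arrangement

namespace GainGraph

variable {V : Type u} {K : Type v} [Field K] {G : Subgroup Kˣ}

/-- The linear form `x_a - g x_b` on `K^V`. -/
def edgeForm (a b : V) (g : Kˣ) : (V → K) →ₗ[K] K :=
  LinearMap.proj a - (g : K) • LinearMap.proj b

/-- The hyperplanes `x_a = g x_b` for the edges `{a,b}_g` and `x_a = 0` for the loops `a`. -/
def frameHyperplanes (Γ : GainGraph V G) : Set (Submodule K (V → K)) :=
  {H | ∃ (a b : V) (g : G), Γ.Edge a b g ∧ H = LinearMap.ker (edgeForm a b (g : Kˣ))} ∪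
    {H | ∃ a ∈ Γ.Loops, H = LinearMap.ker (LinearMap.proj a : (V → K) →ₗ[K] K)}

theorem finite_frameHyperplanes [Finite V] [Finite G] (Γ : GainGraph V G) :
    Γ.frameHyperplanes.Finite := by
  refine Set.Finite.union ?_ ?_
  · refine (Set.finite_range fun t : V × V × G =>
      LinearMap.ker (edgeForm (K := K) t.1 t.2.1 (t.2.2 : Kˣ))).subset ?_
    rintro H ⟨a, b, g, -, rfl⟩
    exact ⟨(a, b, g), rfl⟩
  · refine (Set.finite_range fun a : V =>
      LinearMap.ker (LinearMap.proj a : (V → K) →ₗ[K] K)).subset ?_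
    rintro H ⟨a, -, rfl⟩
    exact ⟨a, rfl⟩

/-- The arrangement `A_×(Γ)` in `K^V`. -/
def frameArrangement [Finite V] [Finite G] (Γ : GainGraph V G) :
    HyperplaneArrangement K (V → K) where
  hyperplanes := Γ.frameHyperplanes
  finite := Γ.finite_frameHyperplanes
  codim_eq_one := by
    classical
    rintro H (⟨a, b, g, hab, rfl⟩ | ⟨a, -, rfl⟩)
    · have hne : a ≠ b := by
        rintro rfl
        exact Γ.irrefl a g hab
      refine LinearMap.codim_ker_eq_one _ fun h => ?_
      have := LinearMap.congr_fun h (Pi.single a 1)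
      simp [edgeForm, Pi.single_eq_of_ne hne.symm] at this
    · refine LinearMap.codim_ker_eq_one _ fun h => ?_
      have := LinearMap.congr_fun h (Pi.single a 1)
      simp at this

end GainGraph

/-! Flats are handled as subspaces of `V → K`, ordered by inclusion. `flatPoly S T P` is the
characteristic polynomial of the interval from `T` to `P`, graded by dimension. If `T` is the centre
of the arrangement, it is χ(M/P); if `T` is a larger flat, it plays the same role for the
localization at `T`. A divisional flag becomes a chain from `⊤` down to the centre, one dimension at
a time, along which these polynomials divide each other.

Divisional flags alone are too weak an induction hypothesis for gluing: in Brylawski's formula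
χ(M)χ(N) = χ(M₁)χ(M₂) (`flatPoly_mul_flatPoly_sup`) the common clique contributes the factor χ(N).
The hypothesis is strengthened to `HasFlags`: for every full clique W (all loops, all edges) some
flag passes through a flat w on which the coordinates in W are free and determine a vector modulo
the centre. When Γ[V₁] and Γ[V₂] are glued along a full clique, take w₂ for that clique in Γ[V₂].
Above w₂ the flag of Γ[V₂] survives, because only one factor of Brylawski's formula varies there.
Below w₂, which is complementary to the modular flat of Γ[V₁], the map Y ↦ w₂ ⊓ Y copies the whole
flag of Γ[V₁].

A bias-simplicial vertex v makes Γ \ v a modular coatom, or all, of the lattice of flats. For a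
hyperplane e outside it, Y ↦ Y ⊓ e turns chains for Γ \ v into chains for Γ that start at e, and the
step from `⊤` to e is divisional by Stanley's modular factorization. The flat w depends on the
position of W relative to v.

The nonempty base cases are loopless, so only W = ∅ matters. K_2^G has rank at most two. The signed
ones have graphic arrangements of chordal graphs after a choice of linear forms, and the simplicial
vertices supplied by Dirac's theorem give modular coatoms. -/

/-! ### Characteristic polynomials of intervals, defined by recursion. -/

open Polynomial Classical in
/-- For a finite set `S` in a poset and a grading `d`, the polynomials with
`∑ Q ∈ S, T ≤ Q ≤ P, charPolyOn S d T Q = X ^ (d P - d T)`. -/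
noncomputable def charPolyOn {α : Type*} [PartialOrder α] [WellFoundedLT α] (S : Finset α)
    (d : α → ℕ) (T : α) : α → ℤ[X] :=
  (wellFounded_lt (α := α)).fix fun P rec => X ^ (d P - d T) -
    ∑ Q ∈ (S.filter fun Q => T ≤ Q ∧ Q < P).attach, rec Q.1 (Finset.mem_filter.1 Q.2).2.2

section CharPolyOn

open Polynomial
open scoped Classical

variable {α : Type*} [PartialOrder α] [WellFoundedLT α] {S : Finset α} {d : α → ℕ} {T P : α}

theorem charPolyOn_eq_sub (S : Finset α) (d : α → ℕ) (T P : α) :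
    charPolyOn S d T P =
      X ^ (d P - d T) - ∑ Q ∈ S with T ≤ Q ∧ Q < P, charPolyOn S d T Q := by
  rw [charPolyOn, WellFounded.fix_eq]
  congr 1
  exact Finset.sum_attach (S.filter fun Q => T ≤ Q ∧ Q < P) (charPolyOn S d T)

omit [WellFoundedLT α] in
theorem filter_Icc_eq_insert (hP : P ∈ S) (hT : T ≤ P) :
    (S.filter fun Q => T ≤ Q ∧ Q ≤ P) = insert P (S.filter fun Q => T ≤ Q ∧ Q < P) := by
  ext Q
  simp only [Finset.mem_filter, Finset.mem_insert]
  constructor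
  · rintro ⟨h1, h2, h3⟩
    rcases h3.eq_or_lt with h | h
    · exact Or.inl h
    · exact Or.inr ⟨h1, h2, h⟩
  · rintro (rfl | ⟨h1, h2, h3⟩)
    · exact ⟨hP, hT, le_rfl⟩
    · exact ⟨h1, h2, h3.le⟩

omit [WellFoundedLT α] in
theorem sum_filter_Icc_eq {R : Type*} [AddCommMonoid R] (f : α → R) (hP : P ∈ S) (hT : T ≤ P) :
    ∑ Q ∈ S with T ≤ Q ∧ Q ≤ P, f Q = f P + ∑ Q ∈ S with T ≤ Q ∧ Q < P, f Q := by
  rw [filter_Icc_eq_insert hP hT, Finset.sum_insert (by simp)]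

theorem sum_charPolyOn (hP : P ∈ S) (hT : T ≤ P) :
    ∑ Q ∈ S with T ≤ Q ∧ Q ≤ P, charPolyOn S d T Q = X ^ (d P - d T) := by
  rw [sum_filter_Icc_eq _ hP hT, charPolyOn_eq_sub S d T P, sub_add_cancel]

/-- The sums over all intervals from `T` determine a function by well-founded induction. This is how
every later identity is proved. The bound `B` allows the hypothesis to be known only below some
element. -/
theorem eq_mul_charPolyOn {f : α → ℤ[X]} {c : ℤ[X]} {B : α}
    (hf : ∀ P ∈ S, T ≤ P → P ≤ B →
      ∑ Q ∈ S with T ≤ Q ∧ Q ≤ P, f Q = c * X ^ (d P - d T)) :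
    ∀ P ∈ S, T ≤ P → P ≤ B → f P = c * charPolyOn S d T P := by
  intro P
  induction P using WellFoundedLT.induction with
  | ind P ih =>
    intro hP hT hB
    have h1 := hf P hP hT hB
    rw [← sum_charPolyOn (d := d) hP hT, Finset.mul_sum, sum_filter_Icc_eq _ hP hT,
      sum_filter_Icc_eq _ hP hT] at h1
    have h2 : ∑ Q ∈ S with T ≤ Q ∧ Q < P, f Q
        = ∑ Q ∈ S with T ≤ Q ∧ Q < P, c * charPolyOn S d T Q := by
      refine Finset.sum_congr rfl fun Q hQ => ?_
      rw [Finset.mem_filter] at hQ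
      exact ih Q hQ.2.2 hQ.1 hQ.2.1 (hQ.2.2.le.trans hB)
    rw [h2] at h1
    exact add_right_cancel h1

theorem natDegree_charPolyOn_le (hd : StrictMono d) (T P : α) :
    (charPolyOn S d T P).natDegree ≤ d P - d T := by
  induction P using WellFoundedLT.induction with
  | ind P ih =>
    rw [charPolyOn_eq_sub]
    refine (natDegree_sub_le _ _).trans (max_le (natDegree_X_pow_le _) ?_)
    refine natDegree_sum_le_of_forall_le _ _ fun Q hQ => ?_
    rw [Finset.mem_filter] at hQ
    have := hd hQ.2.2
    exact (ih Q hQ.2.2).trans (by omega)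

/-- The leading term X ^ (d P - d T) cannot cancel, since all subtracted terms have smaller degree.
Nonvanishing is needed to cancel the clique factor when gluing. -/
theorem charPolyOn_ne_zero (hd : StrictMono d) (T P : α) : charPolyOn S d T P ≠ 0 := by
  intro h0
  have h : (charPolyOn S d T P).coeff (d P - d T) = 1 := by
    rw [charPolyOn_eq_sub, coeff_sub, coeff_X_pow_self, finsetSum_coeff,
      Finset.sum_eq_zero, sub_zero]
    intro Q hQ
    rw [Finset.mem_filter] at hQ
    refine coeff_eq_zero_of_natDegree_lt ((natDegree_charPolyOn_le hd T Q).trans_lt ?_)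
    have := hd hQ.2.2
    have := hd.monotone hQ.2.1
    omega
  rw [h0, coeff_zero] at h
  exact zero_ne_one h

/-- An order embedding onto an upper part of a finite set preserves the polynomials. -/
theorem charPolyOn_transfer {β : Type*} [PartialOrder β] [WellFoundedLT β] {S' : Finset β}
    {d' : β → ℕ} (ι : α ↪o β) (hd : ∀ P Q : α, P ≤ Q → d Q - d P = d' (ι Q) - d' (ι P))
    (hS : ∀ P ∈ S, ι P ∈ S') (hS' : ∀ Q ∈ S', ι T ≤ Q → ∃ P ∈ S, ι P = Q) (hP : P ∈ S)
    (hT : T ≤ P) : charPolyOn S' d' (ι T) (ι P) = charPolyOn S d T P := by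
  have := eq_mul_charPolyOn (S := S) (d := d) (T := T) (c := 1) (B := P)
    (f := fun P => charPolyOn S' d' (ι T) (ι P)) ?_ P hP hT le_rfl
  · rw [this, one_mul]
  intro P hP hT _
  rw [one_mul, hd T P hT, ← sum_charPolyOn (hS P hP) (ι.monotone hT)]
  refine Finset.sum_bij (fun Q _ => ι Q) ?_ ?_ ?_ ?_
  · intro Q hQ
    simp only [Finset.mem_filter, ι.le_iff_le] at hQ ⊢
    exact ⟨hS Q hQ.1, hQ.2⟩
  · exact fun _ _ _ _ h => ι.injective h
  · intro Q hQ
    rw [Finset.mem_filter] at hQ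
    obtain ⟨Q', h1, rfl⟩ := hS' Q hQ.1 hQ.2.1
    simp only [ι.le_iff_le] at hQ
    exact ⟨Q', by simpa using ⟨h1, hQ.2⟩, rfl⟩
  · intros; rfl

/-- The polynomials in terms of a Möbius function. -/
theorem sum_moebius_mul_eq_charPolyOn {m : α → ℤ} (hP : P ∈ S) (hT : T ≤ P)
    (hm : ∀ Q ∈ S, T ≤ Q → Q ≤ P → ∑ R ∈ S with Q ≤ R ∧ R ≤ P, m R = if Q = P then 1 else 0) :
    ∑ Q ∈ S with T ≤ Q ∧ Q ≤ P, C (m Q) * X ^ (d Q - d T) = charPolyOn S d T P := by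
  have h1 : ∀ Q ∈ S.filter (fun Q => T ≤ Q ∧ Q ≤ P), C (m Q) * (X : ℤ[X]) ^ (d Q - d T) =
      ∑ R ∈ S with T ≤ R ∧ R ≤ P, if R ≤ Q then C (m Q) * charPolyOn S d T R else 0 := by
    intro Q hQ
    rw [Finset.mem_filter] at hQ
    rw [← sum_charPolyOn (d := d) hQ.1 hQ.2.1, Finset.mul_sum, ← Finset.sum_filter]
    refine Finset.sum_congr ?_ fun _ _ => rfl
    ext R
    simp only [Finset.mem_filter]
    exact ⟨fun h => ⟨⟨h.1, h.2.1, h.2.2.trans hQ.2.2⟩, h.2.2⟩, fun h => ⟨h.1.1, h.1.2.1, h.2⟩⟩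
  rw [Finset.sum_congr rfl h1, Finset.sum_comm]
  have h2 : ∀ R ∈ S.filter (fun Q => T ≤ Q ∧ Q ≤ P),
      (∑ Q ∈ S with T ≤ Q ∧ Q ≤ P, if R ≤ Q then C (m Q) * charPolyOn S d T R else 0) =
        if R = P then charPolyOn S d T R else 0 := by
    intro R hR
    rw [Finset.mem_filter] at hR
    have := hm R hR.1 hR.2.1 hR.2.2
    rw [← Finset.sum_filter, ← Finset.sum_mul, ← map_sum]
    have h3 : ((S.filter fun Q => T ≤ Q ∧ Q ≤ P).filter fun Q => R ≤ Q)
        = S.filter fun Q => R ≤ Q ∧ Q ≤ P := by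
      ext Q
      simp only [Finset.mem_filter]
      exact ⟨fun h => ⟨h.1.1, h.2, h.1.2.2⟩, fun h => ⟨⟨h.1, hR.2.1.trans h.2.1, h.2.2⟩, h.2.1⟩⟩
    rw [h3, this]
    split_ifs <;> simp
  rw [Finset.sum_congr rfl h2, Finset.sum_ite_eq', if_pos (by simp [hP, hT])]

end CharPolyOn

/-! ### Modular flats and factorizations of characteristic polynomials. -/

section FlatPoly

open Polynomial Module
open scoped Classical

variable {K : Type*} [Field K] {E : Type*} [AddCommGroup E] [Module K E] [FiniteDimensional K E]
  {S : Finset (Submodule K E)} {T X Y C P₁ P₂ : Submodule K E}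

/-- The polynomials `charPolyOn` for a finite set of subspaces, graded by dimension. -/
noncomputable abbrev flatPoly (S : Finset (Submodule K E)) (T P : Submodule K E) : ℤ[X] :=
  charPolyOn S (fun Q : Submodule K E => finrank K Q) T P

/-- A member `X` of a set of subspaces is modular if the set is closed under adding `X`. -/
structure IsModularFlat (S : Finset (Submodule K E)) (X : Submodule K E) : Prop where
  mem : X ∈ S
  sup_mem : ∀ F ∈ S, F ⊔ X ∈ S

theorem strictMono_finrank_submodule : StrictMono fun Q : Submodule K E => finrank K Q :=
  fun _ _ h => Submodule.finrank_lt_finrank_of_lt h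

theorem flatPoly_ne_zero (S : Finset (Submodule K E)) (T P : Submodule K E) :
    flatPoly S T P ≠ 0 :=
  charPolyOn_ne_zero strictMono_finrank_submodule T P

/-- Modularity makes Q ↦ Q ⊔ X a map from the interval over `T` to the interval over `X`. Summing
the fibres over all members between `X` and C gives the full interval from `T` to Y ⊓ C, so
uniqueness identifies each fibre sum. -/
theorem sum_flatPoly_fiber (hS : ∀ P ∈ S, ∀ Q ∈ S, P ⊓ Q ∈ S) (hX : IsModularFlat S X)
    (hTX : T ≤ X) (hY : Y ∈ S) (hTY : T ≤ Y) (hC : C ∈ S) (hXC : X ≤ C) (hCY : C ≤ Y ⊔ X) :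
    ∑ Q ∈ S with (T ≤ Q ∧ Q ≤ Y) ∧ Q ⊔ X = C, flatPoly S T Q
      = Polynomial.X ^ (finrank K ↥(Y ⊓ X) - finrank K T) * flatPoly S X C := by
  refine eq_mul_charPolyOn (B := Y ⊔ X)
    (f := fun C => ∑ Q ∈ S with (T ≤ Q ∧ Q ≤ Y) ∧ Q ⊔ X = C, flatPoly S T Q)
    ?_ C hC hXC hCY
  clear hC hXC hCY
  intro C hC hXC hCY
  have hmap : ∀ Q ∈ S.filter (fun Q => T ≤ Q ∧ Q ≤ Y ⊓ C),
      Q ⊔ X ∈ S.filter fun Q => X ≤ Q ∧ Q ≤ C := by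
    intro Q hQ
    rw [Finset.mem_filter] at hQ ⊢
    exact ⟨hX.sup_mem _ hQ.1, le_sup_right, sup_le (hQ.2.2.trans inf_le_right) hXC⟩
  have h1 := Finset.sum_fiberwise_of_maps_to hmap (flatPoly S T)
  have h2 := sum_charPolyOn (d := fun Q : Submodule K E => finrank K Q) (hS Y hY C hC)
    (le_inf hTY (hTX.trans hXC))
  have hdim : finrank K ↥(Y ⊓ C) - finrank K T =
      (finrank K ↥(Y ⊓ X) - finrank K T) + (finrank K C - finrank K X) := by
    have e1 := Submodule.finrank_sup_add_finrank_inf_eq (Y ⊓ C) X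
    -- The modular law applies because X ≤ C ≤ Y ⊔ X.
    have e2 : Y ⊓ C ⊔ X = C := by
      rw [sup_comm, ← inf_comm C Y, inf_comm, ← sup_inf_assoc_of_le Y hXC, sup_comm,
        inf_eq_right.2 hCY]
    have e3 : Y ⊓ C ⊓ X = Y ⊓ X := by rw [inf_assoc, inf_eq_right.2 hXC]
    rw [e2, e3] at e1
    have e4 := Submodule.finrank_mono hXC
    have e5 := Submodule.finrank_mono (le_inf hTY hTX)
    omega
  rw [← pow_add, ← hdim, ← h2, ← h1]
  refine Finset.sum_congr rfl fun D hD => Finset.sum_congr ?_ fun _ _ => rfl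
  rw [Finset.mem_filter] at hD
  ext Q
  simp only [Finset.mem_filter, le_inf_iff]
  constructor
  · rintro ⟨h1, ⟨h2, h3⟩, rfl⟩
    exact ⟨⟨h1, h2, h3, le_sup_left.trans hD.2.2⟩, rfl⟩
  · rintro ⟨⟨h1, h2, h3, -⟩, h4⟩
    exact ⟨h1, ⟨h2, h3⟩, h4⟩

/-- The fibre over Y ⊔ X contains only `Y`: a smaller member with the same join and the same meet
with `X` would violate the modular law for subspaces. -/
theorem flatPoly_eq_of_inf_eq (hS : ∀ P ∈ S, ∀ Q ∈ S, P ⊓ Q ∈ S) (hX : IsModularFlat S X)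
    (hY : Y ∈ S) (h : Y ⊓ X = T) : flatPoly S T Y = flatPoly S X (Y ⊔ X) := by
  subst h
  have h1 := sum_flatPoly_fiber hS hX inf_le_right hY inf_le_left (hX.sup_mem Y hY) le_sup_right
    le_rfl
  rw [Nat.sub_self, pow_zero, one_mul] at h1
  rw [← h1]
  symm
  refine Finset.sum_eq_single_of_mem Y (by simp [hY]) fun Q hQ hne => absurd ?_ hne
  rw [Finset.mem_filter] at hQ
  obtain ⟨-, ⟨h2, h3⟩, h4⟩ := hQ
  exact eq_of_le_of_inf_le_of_sup_le h3 (le_inf h2 inf_le_right) h4.ge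

/-- Stanley's factorization for a modular coatom. In the fibre over `Y`, every member other than `Y`
meets `X` exactly in `T`, for dimension reasons, and so contributes `flatPoly S X Y`. The whole
fibre sum is a multiple of that polynomial, hence so is the remaining term. -/
theorem flatPoly_dvd_of_finrank_eq (hS : ∀ P ∈ S, ∀ Q ∈ S, P ⊓ Q ∈ S) (hX : IsModularFlat S X)
    (hTX : T ≤ X) (hd : finrank K X = finrank K T + 1) (hY : Y ∈ S) (hXY : X ≤ Y) :
    flatPoly S X Y ∣ flatPoly S T Y := by
  have h1 := sum_flatPoly_fiber hS hX hTX hY (hTX.trans hXY) hY hXY le_sup_left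
  have hmem : Y ∈ S.filter fun Q => (T ≤ Q ∧ Q ≤ Y) ∧ Q ⊔ X = Y := by
    simp [hY, hTX.trans hXY, hXY]
  rw [← Finset.add_sum_erase _ _ hmem] at h1
  have h2 : flatPoly S X Y ∣ ∑ Q ∈ (S.filter fun Q => (T ≤ Q ∧ Q ≤ Y) ∧ Q ⊔ X = Y).erase Y,
      flatPoly S T Q := by
    refine Finset.dvd_sum fun Q hQ => ?_
    rw [Finset.mem_erase, Finset.mem_filter] at hQ
    obtain ⟨hne, hQS, ⟨hTQ, hQY⟩, hsup⟩ := hQ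
    have e1 := Submodule.finrank_sup_add_finrank_inf_eq Q X
    have e2 := Submodule.finrank_lt_finrank_of_lt (lt_of_le_of_ne hQY hne)
    rw [hsup] at e1
    have e3 : T = Q ⊓ X := Submodule.eq_of_le_of_finrank_le (le_inf hTQ hTX) (by omega)
    rw [flatPoly_eq_of_inf_eq hS hX hQS e3.symm, hsup]
  exact (dvd_add_left h2).1 (h1 ▸ dvd_mul_left _ _)

/-- The factorization of the characteristic polynomial of a generalized parallel connection. -/
theorem flatPoly_mul_flatPoly_sup (hS : ∀ P ∈ S, ∀ Q ∈ S, P ⊓ Q ∈ S)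
    (h₁ : IsModularFlat S P₁) (h₂ : IsModularFlat S P₂)
    (hdec : ∀ Y ∈ S, (Y ⊔ P₁) ⊓ (Y ⊔ P₂) ≤ Y) :
    ∀ Y ∈ S, P₁ ⊓ P₂ ≤ Y → flatPoly S (P₁ ⊓ P₂) Y * flatPoly S (P₁ ⊔ P₂) (Y ⊔ (P₁ ⊔ P₂))
      = flatPoly S P₁ (Y ⊔ P₁) * flatPoly S P₂ (Y ⊔ P₂) := by
  have hN : IsModularFlat S (P₁ ⊔ P₂) :=
    ⟨h₂.sup_mem _ h₁.mem, fun F hF => by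
      rw [← sup_assoc]; exact h₂.sup_mem _ (h₁.sup_mem _ hF)⟩
  intro Y
  induction Y using WellFoundedLT.induction with
  | ind Y ih =>
  intro hY hTY
  set T := P₁ ⊓ P₂ with hT
  set N := P₁ ⊔ P₂ with hNdef
  set C := Y ⊔ N with hC
  have hCS : C ∈ S := hN.sup_mem _ hY
  have hP₁N : P₁ ≤ N := le_sup_left
  have hP₂N : P₂ ≤ N := le_sup_right
  have hC₁ : Y ⊔ P₁ ⊔ N = C := by rw [sup_assoc, sup_eq_right.2 hP₁N]
  have hC₂ : Y ⊔ P₂ ⊔ N = C := by rw [sup_assoc, sup_eq_right.2 hP₂N]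
  have hTN : T ≤ N := inf_le_left.trans hP₁N
  -- All three intervals are fibred over the same member C above the modular flat N. The exponents
  -- of the fibre sums add up, so the product of the two right-hand fibre sums matches the left one.
  have f := sum_flatPoly_fiber hS hN hTN hY hTY hCS le_sup_right le_rfl
  have f₁ := sum_flatPoly_fiber hS hN hP₁N (h₁.sup_mem Y hY) le_sup_right hCS le_sup_right
    hC₁.ge
  have f₂ := sum_flatPoly_fiber hS hN hP₂N (h₂.sup_mem Y hY) le_sup_right hCS le_sup_right
    hC₂.ge
  have hYeq : (Y ⊔ P₁) ⊓ (Y ⊔ P₂) = Y := le_antisymm (hdec Y hY) (le_inf le_sup_left le_sup_left)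
  have hexp : finrank K ↥(Y ⊓ N) - finrank K T = (finrank K ↥((Y ⊔ P₁) ⊓ N) - finrank K P₁)
      + (finrank K ↥((Y ⊔ P₂) ⊓ N) - finrank K P₂) := by
    have e1 := Submodule.finrank_sup_add_finrank_inf_eq Y N
    have e2 := Submodule.finrank_sup_add_finrank_inf_eq (Y ⊔ P₁) N
    have e3 := Submodule.finrank_sup_add_finrank_inf_eq (Y ⊔ P₂) N
    have e4 := Submodule.finrank_sup_add_finrank_inf_eq (Y ⊔ P₁) (Y ⊔ P₂)
    have e5 := Submodule.finrank_sup_add_finrank_inf_eq P₁ P₂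
    have e6 : Y ⊔ P₁ ⊔ (Y ⊔ P₂) = C := by rw [← sup_sup_distrib_left]
    rw [← hT, ← hNdef] at e5
    rw [← hC] at e1
    rw [hC₁] at e2
    rw [hC₂] at e3
    rw [e6, hYeq] at e4
    have e7 := Submodule.finrank_mono (le_inf hTY hTN)
    have e8 := Submodule.finrank_mono (le_inf (le_sup_right : P₁ ≤ Y ⊔ P₁) hP₁N)
    have e9 := Submodule.finrank_mono (le_inf (le_sup_right : P₂ ≤ Y ⊔ P₂) hP₂N)
    omega
  have hsum : ∑ Q ∈ S with (T ≤ Q ∧ Q ≤ Y) ∧ Q ⊔ N = C, flatPoly S T Q * flatPoly S N C =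
      ∑ Q ∈ S with (T ≤ Q ∧ Q ≤ Y) ∧ Q ⊔ N = C,
        flatPoly S P₁ (Q ⊔ P₁) * flatPoly S P₂ (Q ⊔ P₂) := by
    rw [← Finset.sum_mul, f]
    trans (∑ Q ∈ S with (P₁ ≤ Q ∧ Q ≤ Y ⊔ P₁) ∧ Q ⊔ N = C, flatPoly S P₁ Q) *
      ∑ Q ∈ S with (P₂ ≤ Q ∧ Q ≤ Y ⊔ P₂) ∧ Q ⊔ N = C, flatPoly S P₂ Q
    · rw [f₁, f₂, hexp, pow_add]
      ring
    rw [Finset.sum_mul_sum, ← Finset.sum_product']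
    symm
    -- A member of the fibre is recovered from its joins with P₁ and P₂ by `hdec`. Conversely, two
    -- members with the same join with N are the joins of their intersection, by the modular law.
    refine Finset.sum_bij' (fun Q _ => (Q ⊔ P₁, Q ⊔ P₂)) (fun Q _ => Q.1 ⊓ Q.2) ?_ ?_ ?_ ?_ ?_
    · intro Q hQ
      simp only [Finset.mem_filter, Finset.mem_product] at hQ ⊢
      obtain ⟨hQS, ⟨-, hQY⟩, hQC⟩ := hQ
      refine ⟨⟨h₁.sup_mem _ hQS, ⟨le_sup_right, sup_le_sup_right hQY _⟩, ?_⟩,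
        h₂.sup_mem _ hQS, ⟨le_sup_right, sup_le_sup_right hQY _⟩, ?_⟩
      · rw [sup_assoc, sup_eq_right.2 hP₁N, hQC]
      · rw [sup_assoc, sup_eq_right.2 hP₂N, hQC]
    · rintro ⟨A, B⟩ hAB
      simp only [Finset.mem_filter, Finset.mem_product] at hAB ⊢
      obtain ⟨⟨hAS, ⟨hA1, hA2⟩, hAC⟩, hBS, ⟨hB1, hB2⟩, hBC⟩ := hAB
      refine ⟨hS A hAS B hBS, ⟨inf_le_inf hA1 hB1, (inf_le_inf hA2 hB2).trans hYeq.le⟩, ?_⟩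
      have : A ⊓ B ⊔ P₁ = A := by
        rw [sup_comm, inf_comm, ← sup_inf_assoc_of_le B hA1, inf_eq_right]
        calc A ≤ C := hAC ▸ le_sup_left
          _ = B ⊔ N := hBC.symm
          _ ≤ P₁ ⊔ B := sup_le le_sup_right (sup_le le_sup_left (hB1.trans le_sup_right))
      rw [hNdef, ← sup_assoc, this, ← hAC, hNdef, ← sup_assoc, sup_eq_left.2 hA1]
    · intro Q hQ
      simp only [Finset.mem_filter] at hQ
      exact le_antisymm (hdec Q hQ.1) (le_inf le_sup_left le_sup_left)
    · rintro ⟨A, B⟩ hAB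
      simp only [Finset.mem_filter, Finset.mem_product] at hAB
      obtain ⟨⟨hAS, ⟨hA1, hA2⟩, hAC⟩, hBS, ⟨hB1, hB2⟩, hBC⟩ := hAB
      refine Prod.ext ?_ ?_
      · change A ⊓ B ⊔ P₁ = A
        rw [sup_comm, inf_comm, ← sup_inf_assoc_of_le B hA1, inf_eq_right]
        calc A ≤ C := hAC ▸ le_sup_left
          _ = B ⊔ N := hBC.symm
          _ ≤ P₁ ⊔ B := sup_le le_sup_right (sup_le le_sup_left (hB1.trans le_sup_right))
      · change A ⊓ B ⊔ P₂ = B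
        rw [sup_comm, ← sup_inf_assoc_of_le A hB1, inf_eq_right]
        calc B ≤ C := hBC ▸ le_sup_left
          _ = A ⊔ N := hAC.symm
          _ ≤ P₂ ⊔ A := sup_le le_sup_right (sup_le (hA1.trans le_sup_right) le_sup_left)
    · intros; rfl
  -- By induction the summands for Q < Y agree, since Q ⊔ N is the same C. Only the summand for `Y`
  -- is left.
  rw [← sub_eq_zero, ← Finset.sum_sub_distrib,
    Finset.sum_eq_single_of_mem Y (by simp [hY, hTY, hC]),
    sub_eq_zero] at hsum
  · exact hsum
  · intro Q hQ hne
    rw [Finset.mem_filter] at hQ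
    obtain ⟨hQS, ⟨hTQ, hQY⟩, hQC⟩ := hQ
    have := ih Q (lt_of_le_of_ne hQY hne) hQS hTQ
    rw [hQC] at this
    rw [this, sub_self]

end FlatPoly

/-! ### Lattices of intersections and chains of divisional steps. -/

section FlatChain

open Polynomial Module

variable {K : Type*} [Field K] {E : Type*} [AddCommGroup E] [Module K E]
  {S : Finset (Submodule K E)} {T X Y C P Q : Submodule K E}

theorem finite_setOf_sInf {𝓗 : Set (Submodule K E)} (h : 𝓗.Finite) :
    {P | ∃ B ⊆ 𝓗, sInf B = P}.Finite :=
  h.finite_subsets.image sInf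

/-- The intersections of members of a finite set of subspaces. -/
noncomputable def intersections {𝓗 : Set (Submodule K E)} (h : 𝓗.Finite) :
    Finset (Submodule K E) :=
  (finite_setOf_sInf h).toFinset

variable {𝓗 𝓗' : Set (Submodule K E)} {h : 𝓗.Finite} {h' : 𝓗'.Finite}

theorem mem_intersections : P ∈ intersections h ↔ ∃ B ⊆ 𝓗, sInf B = P := by
  simp [intersections]

theorem mem_intersections_iff_sInf_le :
    P ∈ intersections h ↔ sInf {H ∈ 𝓗 | P ≤ H} ≤ P := by
  rw [mem_intersections]
  constructor
  · rintro ⟨B, hB, rfl⟩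
    exact sInf_le_sInf fun H hH => ⟨hB hH, sInf_le hH⟩
  · exact fun hP => ⟨{H ∈ 𝓗 | P ≤ H}, fun H hH => hH.1, le_antisymm hP (le_sInf fun H hH => hH.2)⟩

theorem mem_intersections_iff :
    P ∈ intersections h ↔ ∀ x, (∀ H ∈ 𝓗, P ≤ H → x ∈ H) → x ∈ P := by
  rw [mem_intersections_iff_sInf_le, SetLike.le_def]
  simp [Submodule.mem_sInf]

theorem mem_intersections_of_mem (hP : P ∈ 𝓗) : P ∈ intersections h :=
  mem_intersections.2 ⟨{P}, by simpa using hP, by simp⟩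

theorem top_mem_intersections : ⊤ ∈ intersections h :=
  mem_intersections.2 ⟨∅, by simp, by simp⟩

theorem sInf_mem_intersections {B : Set (Submodule K E)} (hB : B ⊆ 𝓗) :
    sInf B ∈ intersections h :=
  mem_intersections.2 ⟨B, hB, rfl⟩

theorem sInf_le_of_mem_intersections (hP : P ∈ intersections h) : sInf 𝓗 ≤ P := by
  obtain ⟨B, hB, rfl⟩ := mem_intersections.1 hP
  exact sInf_le_sInf hB

theorem inf_mem_intersections :
    ∀ P ∈ intersections h, ∀ Q ∈ intersections h, P ⊓ Q ∈ intersections h := by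
  intro P hP Q hQ
  obtain ⟨A, hA, rfl⟩ := mem_intersections.1 hP
  obtain ⟨B, hB, rfl⟩ := mem_intersections.1 hQ
  exact mem_intersections.2 ⟨A ∪ B, Set.union_subset hA hB, sInf_union⟩

variable [FiniteDimensional K E]

/-- A step of a divisional flag. -/
structure FlatStep (S : Finset (Submodule K E)) (T P Q : Submodule K E) : Prop where
  le : Q ≤ P
  bot_le : T ≤ Q
  mem : Q ∈ S
  finrank_eq : finrank K P = finrank K Q + 1
  dvd : flatPoly S T Q ∣ flatPoly S T P

/-- Subspaces that are joined by a part of a divisional flag. -/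
abbrev FlatChain (S : Finset (Submodule K E)) (T : Submodule K E) :
    Submodule K E → Submodule K E → Prop :=
  Relation.ReflTransGen (FlatStep S T)

theorem FlatChain.le (h : FlatChain S T P Q) : Q ≤ P := by
  induction h with
  | refl => exact le_rfl
  | tail _ h ih => exact h.le.trans ih

theorem FlatChain.mem (h : FlatChain S T P Q) (hP : P ∈ S) : Q ∈ S := by
  induction h with
  | refl => exact hP
  | tail _ h ih => exact h.mem

/-- Chains are mapped to chains if the steps between their members are. -/
theorem FlatChain.map {E' : Type*} [AddCommGroup E'] [Module K E'] [FiniteDimensional K E']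
    {S' : Finset (Submodule K E')} {T' : Submodule K E'} (f : Submodule K E → Submodule K E')
    (h : FlatChain S T P Q) (hP : P ∈ S)
    (hf : ∀ A ∈ S, ∀ B, Q ≤ B → FlatStep S T A B → FlatStep S' T' (f A) (f B)) :
    FlatChain S' T' (f P) (f Q) := by
  induction h with
  | refl => exact .refl
  | tail h1 h2 ih =>
    exact (ih fun A hA B hB hAB => hf A hA B (h2.le.trans hB) hAB).tail
      (hf _ (FlatChain.mem h1 hP) _ le_rfl h2)

/-- Flats of a localization are flats of the arrangement, and chains are preserved. -/
theorem FlatChain.comap {E' : Type*} [AddCommGroup E'] [Module K E'] [FiniteDimensional K E']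
    {𝓗' : Set (Submodule K E')} {h' : 𝓗'.Finite} (π : E →ₗ[K] E') (hπ : Function.Surjective π)
    (h1 : ∀ H ∈ 𝓗', H.comap π ∈ 𝓗)
    (h2 : ∀ H ∈ 𝓗, (sInf 𝓗').comap π ≤ H → ∃ H' ∈ 𝓗', H'.comap π = H) {P Q : Submodule K E'}
    (hc : FlatChain (intersections h') (sInf 𝓗') P Q) (hP : P ∈ intersections h') :
    FlatChain (intersections h) ((sInf 𝓗').comap π) (P.comap π) (Q.comap π) := by
  have hsInf : ∀ B : Set (Submodule K E'),
      (sInf B).comap π = sInf ((fun H => H.comap π) '' B) := by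
    intro B
    ext x
    simp [Submodule.mem_sInf]
  -- Preimages gain the dimension of the kernel, a shift that cancels in all dimension differences.
  have hfin : ∀ P : Submodule K E', finrank K (P.comap π) = finrank K P + finrank K π.ker := by
    intro P
    have e1 := LinearMap.finrank_range_add_finrank_ker (π.domRestrict (P.comap π))
    have e2 : LinearMap.range (π.domRestrict (P.comap π)) = P := by
      rw [LinearMap.range_domRestrict, Submodule.map_comap_eq_of_surjective hπ]
    have e3 : finrank K (LinearMap.ker (π.domRestrict (P.comap π))) = finrank K π.ker := by
      rw [LinearMap.ker_domRestrict]
      refine LinearEquiv.finrank_eq (Submodule.comapSubtypeEquivOfLe ?_)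
      intro x hx
      rw [Submodule.mem_comap, LinearMap.mem_ker.1 hx]
      exact P.zero_mem
    rw [e2, e3] at e1
    exact e1.symm
  have hmem : ∀ P ∈ intersections h', P.comap π ∈ intersections h := by
    intro P hP
    obtain ⟨B, hB, rfl⟩ := mem_intersections.1 hP
    exact mem_intersections.2 ⟨_, Set.image_subset_iff.2 fun H hH => h1 H (hB hH), (hsInf B).symm⟩
  have hsurj : ∀ Q ∈ intersections h, (sInf 𝓗').comap π ≤ Q →
      ∃ P ∈ intersections h', P.comap π = Q := by
    intro Q hQ hle
    obtain ⟨B, hB, rfl⟩ := mem_intersections.1 hQ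
    refine ⟨sInf {H' ∈ 𝓗' | H'.comap π ∈ B}, sInf_mem_intersections fun H hH => hH.1, ?_⟩
    rw [hsInf]
    congr 1
    ext H
    constructor
    · rintro ⟨H', hH', rfl⟩
      exact hH'.2
    · intro hH
      obtain ⟨H', hH', rfl⟩ := h2 H (hB hH) (hle.trans (sInf_le hH))
      exact ⟨H', ⟨hH', hH⟩, rfl⟩
  let ι : Submodule K E' ↪o Submodule K E :=
    OrderEmbedding.ofMapLEIff (fun P => P.comap π) fun _ _ =>
      Submodule.comap_le_comap_iff_of_surjective hπ
  have hpoly : ∀ P ∈ intersections h',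
      flatPoly (intersections h) ((sInf 𝓗').comap π) (P.comap π)
        = flatPoly (intersections h') (sInf 𝓗') P := fun P hP =>
    charPolyOn_transfer ι (fun P Q _ => by
      change _ = finrank K (Q.comap π) - finrank K (P.comap π)
      rw [hfin, hfin]
      omega) hmem hsurj hP (sInf_le_of_mem_intersections hP)
  refine FlatChain.map (fun P => P.comap π) hc hP fun A hA B _ hAB => ?_
  refine ⟨Submodule.comap_mono hAB.le, Submodule.comap_mono hAB.bot_le, hmem B hAB.mem, ?_, ?_⟩
  · rw [hfin, hfin, hAB.finrank_eq]
    omega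
  · rw [hpoly A hA, hpoly B hAB.mem]
    exact hAB.dvd

theorem Submodule.isCoatom_of_codim_eq_one {H : Submodule K E} (hH : H.codim = 1) : IsCoatom H := by
  have h1 := H.codim_add_finrank
  refine ⟨?_, fun Q hQ => ?_⟩
  · rintro rfl
    rw [finrank_top] at h1
    omega
  · have h2 := Submodule.codim_strictAnti hQ
    have h3 := Q.codim_add_finrank
    exact Submodule.eq_top_of_finrank_eq (by omega)

theorem finrank_eq_finrank_inf_add_one {H : Submodule K E} (hH : H.codim = 1) (hY : ¬ Y ≤ H) :
    finrank K Y = finrank K ↥(Y ⊓ H) + 1 := by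
  have h1 := H.codim_add_finrank
  have h2 : Y ⊔ H = ⊤ := (Submodule.isCoatom_of_codim_eq_one hH).2 _ (right_lt_sup.2 hY)
  have h3 := Submodule.finrank_sup_add_finrank_inf_eq Y H
  rw [h2, finrank_top] at h3
  omega

/-! ### Modular coatoms and the extension of flags. -/

/-- The hyperplanes in `𝓗'` form a modular coatom (or all) of the lattice of flats of `𝓗`. -/
structure IsModularCoatomIn (𝓗' 𝓗 : Set (Submodule K E)) : Prop where
  subset : 𝓗' ⊆ 𝓗
  codim_eq_one : ∀ H ∈ 𝓗, H.codim = 1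
  not_le : ∀ e ∈ 𝓗, e ∉ 𝓗' → ¬ sInf 𝓗' ≤ e
  exists_line : ∀ e ∈ 𝓗, e ∉ 𝓗' → ∀ f ∈ 𝓗, f ∉ 𝓗' → e ≠ f → ∃ g ∈ 𝓗', e ⊓ f ≤ g ∧ e ⊓ g ≤ f

namespace IsModularCoatomIn

variable {e : Submodule K E}

theorem sup_eq_top (hm : IsModularCoatomIn 𝓗' 𝓗) (he : e ∈ 𝓗) (he' : e ∉ 𝓗')
    (hY : sInf 𝓗' ≤ Y) : e ⊔ Y = ⊤ :=
  (Submodule.isCoatom_of_codim_eq_one (hm.codim_eq_one e he)).2 _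
    (left_lt_sup.2 fun h => hm.not_le e he he' (hY.trans h))

omit [FiniteDimensional K E] in
-- Every further hyperplane f outside `𝓗'` contains e ⊓ g for some g in `𝓗'`, so a single hyperplane
-- `e` cuts the centre of `𝓗'` down to the full centre.
theorem inf_eq (hm : IsModularCoatomIn 𝓗' 𝓗) (he : e ∈ 𝓗) (he' : e ∉ 𝓗') :
    sInf 𝓗' ⊓ e = sInf 𝓗 := by
  refine le_antisymm (le_sInf fun H hH => ?_) (le_inf (sInf_le_sInf hm.subset) (sInf_le he))
  by_cases hH' : H ∈ 𝓗'
  · exact inf_le_left.trans (sInf_le hH')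
  by_cases heH : e = H
  · exact heH ▸ inf_le_right
  obtain ⟨g, hg, -, hle⟩ := hm.exists_line e he he' H hH hH' heH
  exact (le_inf inf_le_right (inf_le_left.trans (sInf_le hg))).trans hle

theorem isModularFlat (hm : IsModularCoatomIn 𝓗' 𝓗) :
    IsModularFlat (intersections h) (sInf 𝓗') := by
  refine ⟨sInf_mem_intersections hm.subset, fun F hF => ?_⟩
  by_cases hXF : sInf 𝓗' ≤ F
  · rwa [sup_eq_left.2 hXF]
  rw [mem_intersections_iff_sInf_le] at hF
  have hex : ∃ e ∈ 𝓗, F ≤ e ∧ e ∉ 𝓗' := by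
    by_contra! hcon
    exact hXF (le_trans (le_sInf fun H hH => sInf_le (hcon H hH.1 hH.2)) hF)
  obtain ⟨e, he, hFe, he'⟩ := hex
  rw [mem_intersections_iff]
  intro x hx
  have hxtop : x ∈ e ⊔ sInf 𝓗' := by
    rw [hm.sup_eq_top he he' le_rfl]
    trivial
  -- Moving along the centre of `𝓗'` puts the vector into e. The component a then lies in F: for a
  -- hyperplane H outside `𝓗'` containing F, the third hyperplane g through e ⊓ H belongs to `𝓗'`,
  -- and e ⊓ g ≤ H.
  obtain ⟨a, ha, b, hb, rfl⟩ := Submodule.mem_sup.1 hxtop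
  have key : ∀ H ∈ 𝓗', F ≤ H → a ∈ H := by
    intro H hH hFH
    have h1 : b ∈ H := Submodule.mem_sInf.1 hb H hH
    have h2 := hx H (hm.subset hH) (sup_le hFH (sInf_le hH))
    simpa using H.sub_mem h2 h1
  refine Submodule.add_mem_sup (hF (Submodule.mem_sInf.2 ?_)) hb
  rintro H ⟨hH, hFH⟩
  by_cases hH' : H ∈ 𝓗'
  · exact key H hH' hFH
  by_cases heH : e = H
  · exact heH ▸ ha
  obtain ⟨g, hg, hle, hle'⟩ := hm.exists_line e he he' H hH hH' heH
  exact hle' ⟨ha, key g hg ((le_inf hFe hFH).trans hle)⟩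

/-- Below `e` the arrangement looks like the localization at the modular coatom: `e` is a complement
of `sInf 𝓗'` modulo the centre, and Y ⊓ e joined with `sInf 𝓗'` returns `Y`. -/
theorem flatPoly_inf (hm : IsModularCoatomIn 𝓗' 𝓗) (he : e ∈ 𝓗) (he' : e ∉ 𝓗')
    (hY : Y ∈ intersections h) (hXY : sInf 𝓗' ≤ Y) :
    flatPoly (intersections h) (sInf 𝓗) (Y ⊓ e) = flatPoly (intersections h) (sInf 𝓗') Y := by
  rw [flatPoly_eq_of_inf_eq inf_mem_intersections hm.isModularFlat
    (inf_mem_intersections _ hY _ (mem_intersections_of_mem he))]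
  · congr 1
    rw [inf_comm, sup_comm, ← sup_inf_assoc_of_le e hXY, sup_comm, hm.sup_eq_top he he' le_rfl,
      top_inf_eq]
  · rw [inf_right_comm, inf_eq_right.2 hXY, hm.inf_eq he he']

theorem flatStep_inf (hm : IsModularCoatomIn 𝓗' 𝓗) (he : e ∈ 𝓗) (he' : e ∉ 𝓗')
    (hY : Y ∈ intersections h) (hXY : sInf 𝓗' ≤ Y) :
    FlatStep (intersections h) (sInf 𝓗) Y (Y ⊓ e) where
  le := inf_le_left
  bot_le := le_inf (sInf_le_of_mem_intersections hY) (sInf_le he)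
  mem := inf_mem_intersections _ hY _ (mem_intersections_of_mem he)
  finrank_eq := finrank_eq_finrank_inf_add_one (hm.codim_eq_one e he) fun h =>
    hm.not_le e he he' (hXY.trans h)
  dvd := by
    rw [hm.flatPoly_inf he he' hY hXY]
    refine flatPoly_dvd_of_finrank_eq inf_mem_intersections hm.isModularFlat
      (sInf_le_sInf hm.subset) ?_ hY hXY
    rw [← hm.inf_eq he he']
    exact finrank_eq_finrank_inf_add_one (hm.codim_eq_one e he) (hm.not_le e he he')

theorem flatChain_inf (hm : IsModularCoatomIn 𝓗' 𝓗) (he : e ∈ 𝓗) (he' : e ∉ 𝓗')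
    (hc : FlatChain (intersections h) (sInf 𝓗') P Q) (hP : P ∈ intersections h)
    (hQ : sInf 𝓗' ≤ Q) :
    FlatChain (intersections h) (sInf 𝓗) (P ⊓ e) (Q ⊓ e) := by
  refine FlatChain.map (fun Y => Y ⊓ e) hc hP fun A hA B hQB hAB => ?_
  have hXB := hQ.trans hQB
  refine ⟨inf_le_inf_right _ hAB.le, le_inf (sInf_le_of_mem_intersections hAB.mem) (sInf_le he),
    inf_mem_intersections _ hAB.mem _ (mem_intersections_of_mem he), ?_, ?_⟩
  · have h1 := (hm.flatStep_inf he he' hA (hXB.trans hAB.le)).finrank_eq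
    have h2 := (hm.flatStep_inf he he' hAB.mem hXB).finrank_eq
    have := hAB.finrank_eq
    change finrank K ↥(A ⊓ e) = finrank K ↥(B ⊓ e) + 1
    omega
  · rw [hm.flatPoly_inf he he' hA (hXB.trans hAB.le), hm.flatPoly_inf he he' hAB.mem hXB]
    exact hAB.dvd

/-- Step from `⊤` to some e outside `𝓗'`, then follow the given chain intersected with e. If no such
e exists, the two arrangements coincide. -/
theorem flatChain_top (hm : IsModularCoatomIn 𝓗' 𝓗)
    (hc : FlatChain (intersections h') (sInf 𝓗') ⊤ (sInf 𝓗')) :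
    FlatChain (intersections h) (sInf 𝓗) ⊤ (sInf 𝓗) := by
  by_cases hex : ∃ e ∈ 𝓗, e ∉ 𝓗'
  · obtain ⟨e, he, he'⟩ := hex
    have hc' := FlatChain.comap (h := h) (LinearMap.id : E →ₗ[K] E) Function.surjective_id
      (fun H hH => hm.subset hH)
      (fun H hH hle => ⟨H, by
        by_contra hH'
        exact hm.not_le H hH hH' (by simpa using hle), by simp⟩) hc top_mem_intersections
    simp only [Submodule.comap_id] at hc'
    have := hm.flatChain_inf he he' hc' top_mem_intersections le_rfl
    rw [hm.inf_eq he he'] at this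
    exact this.head (hm.flatStep_inf he he' top_mem_intersections le_top)
  · push Not at hex
    obtain rfl : 𝓗' = 𝓗 := subset_antisymm hm.subset hex
    exact hc

end IsModularCoatomIn

end FlatChain

/-! ### From subspaces back to the matroid of an arrangement. -/

namespace Matroid

variable {α : Type*}

theorem eRk_contract_add_eRk (M : Matroid α) {F X : Set α} (hF : F ⊆ M.E) (hX : X ⊆ M.E)
    (hd : Disjoint F X) : (M ／ X).eRk F + M.eRk X = M.eRk (F ∪ X) := by
  obtain ⟨I, hI⟩ := M.exists_isBasis X
  obtain ⟨J, hJ, hIJ⟩ := hI.indep.subset_isBasis_of_subset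
    (hI.subset.trans Set.subset_union_right) (Set.union_subset hF hX)
  have hJX : J ∩ X = I := (hI.eq_of_subset_indep (hJ.indep.inter_right X)
    (Set.subset_inter hIJ hI.subset) Set.inter_subset_right).symm
  have hJI : J \ X ∪ I = J := by rw [← hJX, Set.sdiff_union_inter]
  have hb := hJ.contract_isBasis hI (by rw [hJI]; exact hJ.indep)
  rw [Set.union_sdiff_right, hd.sdiff_eq_left] at hb
  rw [hb.eRk_eq_encard, hI.eRk_eq_encard, hJ.eRk_eq_encard,
    ← Set.encard_union_eq (Set.disjoint_sdiff_left.mono_right hI.subset), hJI]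

theorem sum_flatMoebius_le (M : Matroid α) [M.Finite] [Fintype M.FlatType]
    [DecidableEq M.FlatType] [DecidableLE M.FlatType] (F : M.FlatType) :
    ∑ F' : M.FlatType with F' ≤ F, M.flatMoebius F' = if F.1 = M.closure ∅ then 1 else 0 := by
  classical
  let _ : LocallyFiniteOrder M.FlatType := Fintype.toLocallyFiniteOrder
  have h := IncidenceAlgebra.sum_Icc_mu_right (𝕜 := ℤ)
    (⟨M.closure ∅, M.isFlat_closure ∅⟩ : M.FlatType) F
  convert h using 1
  · refine Finset.sum_congr ?_ fun F' _ => ?_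
    · ext F'
      simp only [Finset.mem_filter, Finset.mem_univ, true_and, Finset.mem_Icc, iff_and_self]
      intro _
      exact (M.closure_subset_closure (Set.empty_subset F'.1)).trans F'.2.closure.subset
    · unfold flatMoebius
      congr!
  · simp only [Subtype.ext_iff, eq_comm]

end Matroid

namespace HyperplaneArrangement

open Module
open scoped Matroid

variable {K : Type*} [Field K] {E : Type*} [AddCommGroup E] [Module K E]

/-- The hyperplanes of an arrangement that contain a subspace. -/
def above (A : HyperplaneArrangement K E) (P : Submodule K E) : Set (Submodule K E) :=
  {H ∈ A.hyperplanes | P ≤ H}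

theorem above_subset (A : HyperplaneArrangement K E) (P : Submodule K E) :
    A.above P ⊆ A.hyperplanes := fun _ h => h.1

theorem above_anti (A : HyperplaneArrangement K E) {P Q : Submodule K E} (h : Q ≤ P) :
    A.above P ⊆ A.above Q := fun _ hH => ⟨hH.1, h.trans hH.2⟩

theorem sInf_above (A : HyperplaneArrangement K E) {P : Submodule K E}
    (hP : P ∈ intersections A.finite) : sInf (A.above P) = P :=
  le_antisymm (mem_intersections_iff_sInf_le.1 hP) (le_sInf fun _ h => h.2)

variable [FiniteDimensional K E] (A : HyperplaneArrangement K E)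

theorem matroid_indep_iff {I : Set (Submodule K E)} :
    A.matroid.Indep I ↔ I ⊆ A.hyperplanes ∧ (sInf I).codim = I.ncard := by
  simp [matroid]

theorem mem_closure_iff_of_indep {I : Set (Submodule K E)} (hI : A.matroid.Indep I)
    {H : Submodule K E} (hH : H ∈ A.hyperplanes) : H ∈ A.matroid.closure I ↔ sInf I ≤ H := by
  have hI' := A.matroid_indep_iff.1 hI
  have hfin := A.finite.subset hI'.1
  by_cases hHI : H ∈ I
  · exact iff_of_true (A.matroid.mem_closure_of_mem' hHI hH) (sInf_le hHI)
  rw [← not_iff_not, hI.notMem_closure_iff_of_notMem hHI hH, A.matroid_indep_iff, sInf_insert,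
    Set.ncard_insert_of_notMem hHI hfin, Set.insert_subset_iff]
  constructor
  · rintro ⟨-, h2⟩ hle
    rw [inf_eq_right.2 hle] at h2
    omega
  · intro hle
    refine ⟨⟨hH, hI'.1⟩, le_antisymm ?_ ?_⟩
    · have := Submodule.codim_inf_le H (sInf I)
      have := A.codim_eq_one H hH
      omega
    · have := Submodule.codim_strictAnti (inf_lt_right.2 hle)
      omega

theorem sInf_eq_of_isBasis {I X : Set (Submodule K E)} (h : A.matroid.IsBasis I X) :
    sInf I = sInf X := by
  refine le_antisymm (le_sInf fun H hH => ?_) (sInf_le_sInf h.subset)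
  exact (A.mem_closure_iff_of_indep h.indep (h.subset_ground hH)).1 (h.subset_closure hH)

theorem closure_eq_above {X : Set (Submodule K E)} (hX : X ⊆ A.hyperplanes) :
    A.matroid.closure X = A.above (sInf X) := by
  obtain ⟨I, hI⟩ := A.matroid.exists_isBasis X hX
  ext H
  rw [← hI.closure_eq_closure, ← A.sInf_eq_of_isBasis hI]
  constructor
  · intro h
    have hH : H ∈ A.hyperplanes := A.matroid.closure_subset_ground _ h
    exact ⟨hH, (A.mem_closure_iff_of_indep hI.indep hH).1 h⟩
  · exact fun h => (A.mem_closure_iff_of_indep hI.indep h.1).2 h.2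

theorem natRk_eq_codim {X : Set (Submodule K E)} (hX : X ⊆ A.hyperplanes) :
    A.matroid.natRk X = (sInf X).codim := by
  obtain ⟨I, hI⟩ := A.matroid.exists_isBasis X hX
  rw [Matroid.natRk, hI.eRk_eq_encard, ← A.sInf_eq_of_isBasis hI,
    (A.matroid_indep_iff.1 hI.indep).2, Set.ncard]

theorem natRk_contract {X F : Set (Submodule K E)} (hX : X ⊆ A.hyperplanes)
    (hF : F ⊆ A.hyperplanes) (hd : Disjoint F X) :
    (A.matroid ／ X).natRk F + (sInf X).codim = (sInf (F ∪ X)).codim := by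
  rw [← A.natRk_eq_codim hX, ← A.natRk_eq_codim (Set.union_subset hF hX), Matroid.natRk,
    Matroid.natRk, Matroid.natRk, ← A.matroid.eRk_contract_add_eRk hF hX hd, ENat.toNat_add]
  · exact ne_top_of_le_ne_top (Set.encard_ne_top_iff.2 (A.finite.subset hF))
      (Matroid.eRk_le_encard _ _)
  · exact ne_top_of_le_ne_top (Set.encard_ne_top_iff.2 (A.finite.subset hX))
      (Matroid.eRk_le_encard _ _)

theorem isFlat_above (P : Submodule K E) : A.matroid.IsFlat (A.above P) := by
  rw [Matroid.isFlat_iff_closure_eq, A.closure_eq_above (A.above_subset P)]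
  refine subset_antisymm (fun H hH => ⟨hH.1, ?_⟩) fun H hH => ⟨hH.1, sInf_le hH⟩
  exact le_trans (le_sInf fun _ h => h.2) hH.2

theorem isFlat_contract_above {P Q : Submodule K E} (hQP : Q ≤ P) :
    (A.matroid ／ A.above P).IsFlat (A.above Q \ A.above P) := by
  rw [Matroid.isFlat_iff_closure_eq, Matroid.contract_closure_eq,
    Set.sdiff_union_of_subset (A.above_anti hQP), (A.isFlat_above Q).closure]

/-- Flats of M/P correspond to the intersections contained in `P`, with the order reversed. The
Möbius function from the least flat becomes one based at the top element `P`, which is the form that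
`sum_moebius_mul_eq_charPolyOn` accepts. -/
theorem charPoly_contract_above {P : Submodule K E} (hP : P ∈ intersections A.finite) :
    (A.matroid ／ A.above P).charPoly =
      flatPoly (intersections A.finite) (sInf A.hyperplanes) P := by
  classical
  set N := A.matroid ／ A.above P with hN
  set S := intersections A.finite with hS
  let _ := Fintype.ofFinite N.FlatType
  have hcl : ∀ Y, N.closure Y = A.matroid.closure (Y ∪ A.above P) \ A.above P := fun Y =>
    A.matroid.contract_closure_eq _ _
  have hground : ∀ F : N.FlatType, F.1 ⊆ A.hyperplanes ∧ Disjoint F.1 (A.above P) := by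
    intro F
    exact Set.subset_sdiff.1 F.2.subset_ground
  let back : N.FlatType → Submodule K E := fun F => sInf (F.1 ∪ A.above P)
  have hback_mem : ∀ F, back F ∈ S := fun F =>
    sInf_mem_intersections (Set.union_subset (hground F).1 (A.above_subset P))
  have hback_le : ∀ F, back F ≤ P := fun F =>
    (sInf_le_sInf Set.subset_union_right).trans (A.sInf_above hP).le
  have hback_above : ∀ F, A.above (back F) \ A.above P = F.1 := by
    intro F
    have h := F.2.closure
    rwa [hcl, A.closure_eq_above
      (Set.union_subset (hground F).1 (A.above_subset P))] at h
  -- The value 0 is a default outside the interval below P and never enters the sums.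
  let m : Submodule K E → ℤ := fun Q =>
    if h : Q ≤ P then N.flatMoebius ⟨A.above Q \ A.above P, A.isFlat_contract_above h⟩ else 0
  have hm : ∀ F, m (back F) = N.flatMoebius F := by
    intro F
    simp only [m, dif_pos (hback_le F)]
    congr 1
    exact Subtype.ext (hback_above F)
  have hback_surj : ∀ Q ∈ S, ∀ h : Q ≤ P,
      back ⟨A.above Q \ A.above P, A.isFlat_contract_above h⟩ = Q := by
    intro Q hQ h
    change sInf (A.above Q \ A.above P ∪ A.above P) = Q
    rw [Set.sdiff_union_of_subset (A.above_anti h), A.sInf_above hQ]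
  have hinj : Function.Injective back := fun F F' h =>
    Subtype.ext (by rw [← hback_above F, ← hback_above F', h])
  have hle : ∀ F F' : N.FlatType, F ≤ F' ↔ back F' ≤ back F := by
    intro F F'
    constructor
    · exact fun h => sInf_le_sInf (Set.union_subset_union_left _ h)
    · intro h
      change F.1 ⊆ F'.1
      rw [← hback_above F, ← hback_above F']
      exact Set.sdiff_subset_sdiff_left (A.above_anti h)
  have hclosure : N.closure ∅ = ∅ := by
    rw [hcl, Set.empty_union, (A.isFlat_above P).closure,
      Set.sdiff_self]
  rw [flatPoly, ← sum_moebius_mul_eq_charPolyOn (m := m) hP (sInf_le_of_mem_intersections hP)]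
  · unfold Matroid.charPoly
    refine Finset.sum_bij (fun F _ => back F) ?_ ?_ ?_ ?_
    · intro F _
      exact Finset.mem_filter.2 ⟨hback_mem F, sInf_le_of_mem_intersections (hback_mem F),
        hback_le F⟩
    · exact fun F _ F' _ h => hinj h
    · intro Q hQ
      rw [Finset.mem_filter] at hQ
      exact ⟨_, Finset.mem_univ _, hback_surj Q hQ.1 hQ.2.2⟩
    · intro F _
      rw [hm]
      congr 2
      change N.natRk N.E - N.natRk F.1 = finrank K (back F) - finrank K ↥(sInf A.hyperplanes)
      have e1 : N.natRk F.1 + _ = (back F).codim :=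
        A.natRk_contract (A.above_subset P) (hground F).1 (hground F).2
      have e2 : N.natRk N.E + _ = _ :=
        A.natRk_contract (A.above_subset P) (F := N.E) Set.sdiff_subset
        Set.disjoint_sdiff_left
      have e3 : N.E ∪ A.above P = A.hyperplanes := Set.sdiff_union_of_subset (A.above_subset P)
      rw [e3] at e2
      have e4 := (sInf A.hyperplanes).codim_add_finrank
      have e5 := (back F).codim_add_finrank
      omega
  · intro Q hQ _ hQP
    obtain ⟨F, rfl⟩ : ∃ F, back F = Q := ⟨_, hback_surj Q hQ hQP⟩
    have h := N.sum_flatMoebius_le F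
    rw [hclosure] at h
    have hiff : back F = P ↔ F.1 = ∅ := by
      constructor
      · intro h
        rw [← hback_above F, h, Set.sdiff_self]
      · intro h
        change sInf (F.1 ∪ A.above P) = P
        rw [h, Set.empty_union, A.sInf_above hP]
    refine Eq.trans ?_ (h.trans (by simp only [hiff]))
    symm
    refine Finset.sum_bij (fun F _ => back F) ?_ ?_ ?_ ?_
    · intro F' hF'
      rw [Finset.mem_filter] at hF'
      exact Finset.mem_filter.2 ⟨hback_mem F', (hle F' F).1 hF'.2, hback_le F'⟩
    · exact fun F _ F' _ h => hinj h
    · intro Q hQ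
      rw [Finset.mem_filter] at hQ
      have hb := hback_surj Q hQ.1 hQ.2.2
      refine ⟨_, Finset.mem_filter.2 ⟨Finset.mem_univ _, ?_⟩, hb⟩
      rw [hle, hb]
      exact hQ.2.1
    · exact fun F' _ => (hm F').symm

/-- Each step raises the codimension by one, so codimension indexes the members of the chain. -/
theorem exists_flag_of_flatChain {P : Submodule K E}
    (h : FlatChain (intersections A.finite) (sInf A.hyperplanes) ⊤ P) :
    ∃ f : ℕ → Submodule K E, f 0 = ⊤ ∧ f P.codim = P ∧
      (∀ i ≤ P.codim, f i ∈ intersections A.finite ∧ (f i).codim = i) ∧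
      ∀ i < P.codim, FlatStep (intersections A.finite) (sInf A.hyperplanes) (f i) (f (i + 1)) := by
  induction h with
  | refl =>
    have h0 : (⊤ : Submodule K E).codim = 0 := by
      have := (⊤ : Submodule K E).codim_add_finrank
      rw [finrank_top] at this
      omega
    refine ⟨fun _ => ⊤, rfl, rfl, fun i hi => ⟨top_mem_intersections, ?_⟩, fun i hi => ?_⟩
    · change (⊤ : Submodule K E).codim = i
      omega
    · omega
  | @tail P Q _ hstep ih =>
    obtain ⟨f, h0, h1, h2, h3⟩ := ih
    have hcodim : Q.codim = P.codim + 1 := by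
      have := P.codim_add_finrank
      have := Q.codim_add_finrank
      have := hstep.finrank_eq
      omega
    refine ⟨Function.update f Q.codim Q, ?_, Function.update_self .., fun i hi => ?_,
      fun i hi => ?_⟩
    · rw [Function.update_of_ne (by omega), h0]
    · rcases hi.eq_or_lt with rfl | hi
      · rw [Function.update_self]
        exact ⟨hstep.mem, rfl⟩
      · rw [Function.update_of_ne hi.ne]
        exact h2 i (by omega)
    · rw [Function.update_of_ne hi.ne]
      rcases (show i + 1 ≤ Q.codim from hi).eq_or_lt with heq | hlt
      · rw [heq, Function.update_self]
        obtain rfl : i = P.codim := by omega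
        rwa [h1]
      · rw [Function.update_of_ne hlt.ne]
        exact h3 i (by omega)

theorem isDivisionallyFree_of_flatChain
    (h : FlatChain (intersections A.finite) (sInf A.hyperplanes) ⊤ (sInf A.hyperplanes)) :
    A.IsDivisionallyFree := by
  obtain ⟨f, h0, h1, h2, h3⟩ := A.exists_flag_of_flatChain h
  have hr : A.matroid.natRk A.matroid.E = (sInf A.hyperplanes).codim := A.natRk_eq_codim subset_rfl
  unfold IsDivisionallyFree Matroid.HasDivisionalFlag
  rw [hr]
  refine ⟨fun i => A.above (f i), ?_, ?_, fun i hi => ⟨A.isFlat_above _, ?_⟩, fun i hi => ⟨?_, ?_⟩⟩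
  · ext H
    simp only [h0, above, top_le_iff, Set.mem_ofPred_eq, Set.mem_empty_iff_false, iff_false]
    rintro ⟨hH, rfl⟩
    exact (Submodule.isCoatom_of_codim_eq_one (A.codim_eq_one _ hH)).1 rfl
  · simp only [h1]
    exact subset_antisymm (A.above_subset _) fun H hH => ⟨hH, sInf_le hH⟩
  · rw [A.natRk_eq_codim (A.above_subset _), A.sInf_above (h2 i hi).1, (h2 i hi).2]
  · exact A.above_anti (h3 i hi).le
  · rw [A.charPoly_contract_above (h2 i hi.le).1, A.charPoly_contract_above (h2 (i + 1) hi).1]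
    exact (h3 i hi).dvd

end HyperplaneArrangement

/-! ### Dirac's theorem on simplicial vertices of chordal graphs. -/

namespace SimpleGraph

variable {V : Type*} (G : SimpleGraph V)

/-- The neighbours of `a` in `U` are pairwise adjacent. -/
def IsSimplicialIn (U : Set V) (a : V) : Prop :=
  ∀ b ∈ U, ∀ c ∈ U, b ≠ c → G.Adj a b → G.Adj a c → G.Adj b c

variable {G}

/-- A walk that is shortest among those supported in `D` has no chords. -/
theorem Walk.mem_edges_of_minimal {D : Set V} {x y s t : V} {q : G.Walk x y}
    (hD : ∀ z ∈ q.support, z ∈ D)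
    (hmin : ∀ p : G.Walk x y, (∀ z ∈ p.support, z ∈ D) → q.length ≤ p.length)
    (hs : s ∈ q.support) (ht : t ∈ q.support) (hst : G.Adj s t) : s(s, t) ∈ q.edges := by
  classical
  have key : ∀ (s t : V) (q₁ : G.Walk x s) (q₂ : G.Walk s t) (q₃ : G.Walk t y),
      G.Adj s t → q₁.append (q₂.append q₃) = q → s(s, t) ∈ q.edges := by
    rintro s t q₁ q₂ q₃ hst rfl
    -- Shortcutting the middle part by the edge st cannot shorten the walk, so that part already has
    -- length one.
    have hle := hmin (q₁.append (.cons hst q₃)) fun z hz => by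
      apply hD
      rw [Walk.mem_support_append_iff, Walk.support_cons, List.mem_cons] at hz
      simp only [Walk.mem_support_append_iff]
      rcases hz with hz | rfl | hz
      · exact Or.inl hz
      · exact Or.inl q₁.end_mem_support
      · exact Or.inr (Or.inr hz)
    simp only [Walk.length_append, Walk.length_cons] at hle
    have hq₂ : s(s, t) ∈ q₂.edges := by
      cases q₂ with
      | nil => exact absurd hst (G.irrefl)
      | cons h r =>
        cases r with
        | nil => simp
        | cons h' r' =>
          simp only [Walk.length_cons] at hle
          omega
    simp [Walk.edges_append, hq₂]
  by_cases h : t ∈ (q.dropUntil s hs).support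
  · refine key s t (q.takeUntil s hs) ((q.dropUntil s hs).takeUntil t h)
      ((q.dropUntil s hs).dropUntil t h) hst ?_
    rw [Walk.take_spec, Walk.take_spec]
  · have h' : t ∈ (q.takeUntil s hs).support := by
      rw [← Walk.take_spec q hs, Walk.mem_support_append_iff] at ht
      exact ht.resolve_right h
    rw [Sym2.eq_swap]
    refine key t s ((q.takeUntil s hs).takeUntil t h') ((q.takeUntil s hs).dropUntil t h')
      (q.dropUntil s hs) hst.symm ?_
    rw [Walk.append_assoc, Walk.take_spec, Walk.take_spec]

/-- In a chordal graph, two neighbours of `a` that are joined by a walk which avoids the other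
neighbours of `a` are adjacent. -/
theorem IsChordalGraph.adj_of_walk (hG : G.IsChordalGraph) {a x y : V} {C : Set V}
    (hax : G.Adj a x) (hay : G.Adj a y) (hxy : x ≠ y) (hC : ∀ c ∈ C, c ≠ a ∧ ¬ G.Adj a c)
    (p : G.Walk x y) (hp : ∀ z ∈ p.support, z = x ∨ z = y ∨ z ∈ C) : G.Adj x y := by
  classical
  by_contra hnadj
  let D : Set V := {z | z = x ∨ z = y ∨ z ∈ C}
  have hex : ∃ n, ∃ p : G.Walk x y, (∀ z ∈ p.support, z ∈ D) ∧ p.length = n := ⟨_, p, hp, rfl⟩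
  obtain ⟨q₀, hq₀D, hq₀⟩ := Nat.find_spec hex
  have hmin₀ : ∀ p : G.Walk x y, (∀ z ∈ p.support, z ∈ D) → q₀.length ≤ p.length :=
    fun p hp => hq₀ ▸ Nat.find_min' hex ⟨p, hp, rfl⟩
  set q := q₀.bypass with hq
  have hqD : ∀ z ∈ q.support, z ∈ D := fun z hz => hq₀D z (q₀.support_bypass_subset_support hz)
  have hmin : ∀ p : G.Walk x y, (∀ z ∈ p.support, z ∈ D) → q.length ≤ p.length :=
    fun p hp => (q₀.length_bypass_le_length).trans (hmin₀ p hp)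
  have hpath : q.IsPath := q₀.bypass_isPath
  have haq : a ∉ q.support := by
    intro h
    rcases hqD a h with h | h | h
    · exact hax.ne h
    · exact hay.ne h
    · exact (hC a h).1 rfl
  have hlen : 2 ≤ q.length := by
    by_contra! hlt
    have h01 : q.length = 0 ∨ q.length = 1 := by omega
    rcases h01 with h | h
    · exact hxy (Walk.eq_of_length_eq_zero h)
    · exact hnadj (Walk.adj_of_length_eq_one h)
  -- Closing the shortest path through a gives a cycle of length at least four. It has no chord:
  -- neither at a, which has no neighbour in C, nor within q, which is shortest.
  have hcyc : (Walk.cons hax (q.concat hay.symm)).IsCycle := by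
    rw [Walk.cons_isCycle_iff]
    refine ⟨hpath.concat haq hay.symm, fun h => ?_⟩
    rw [Walk.edges_concat, List.concat_eq_append, List.mem_append, List.mem_singleton] at h
    rcases h with h | h
    · exact haq (q.fst_mem_support_of_mem_edges h)
    · rcases Sym2.eq_iff.1 h with ⟨h1, h2⟩ | ⟨-, h2⟩
      · exact hax.ne h2.symm
      · exact hxy h2
  have hchord : ∀ t, t ∈ q.support → G.Adj a t → t = x ∨ t = y := by
    intro t ht hat
    rcases hqD t ht with h | h | h
    · exact Or.inl h
    · exact Or.inr h
    · exact absurd hat (hC t h).2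
  have hsupp : ∀ t, t ∈ (Walk.cons hax (q.concat hay.symm)).support → t = a ∨ t ∈ q.support := by
    intro t ht
    rw [Walk.support_cons, Walk.support_concat, List.mem_cons, List.mem_append,
      List.mem_singleton] at ht
    tauto
  obtain ⟨s, hs, t, ht, hst, hnot⟩ := hG a _ hcyc (by
    rw [Walk.length_cons, Walk.length_concat]
    omega)
  apply hnot
  rw [Walk.edges_cons, Walk.edges_concat, List.mem_cons, List.concat_eq_append, List.mem_append,
    List.mem_singleton]
  rcases hsupp s hs with rfl | hs'
  · rcases hsupp t ht with rfl | ht'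
    · exact absurd hst (G.irrefl)
    · rcases hchord t ht' hst with rfl | rfl
      · exact Or.inl rfl
      · exact Or.inr (Or.inr Sym2.eq_swap)
  · rcases hsupp t ht with rfl | ht'
    · rcases hchord s hs' hst.symm with rfl | rfl
      · exact Or.inl Sym2.eq_swap
      · exact Or.inr (Or.inr rfl)
    · exact Or.inr (Or.inl (Walk.mem_edges_of_minimal hqD hmin hs' ht' hst))

/-- Dirac's theorem: a chordal graph has a simplicial vertex outside any proper clique. -/
theorem IsChordalGraph.exists_isSimplicialIn_notMem (hG : G.IsChordalGraph) (U : Finset V) :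
    ∀ Q : Set V, (∀ x ∈ Q, ∀ y ∈ Q, x ≠ y → G.Adj x y) → (∃ u ∈ U, u ∉ Q) →
      ∃ a ∈ U, a ∉ Q ∧ G.IsSimplicialIn U a := by
  classical
  induction U using Finset.strongInduction with
  | H U ih =>
  intro Q hQ ⟨u, hu, huQ⟩
  by_cases hcomplete : ∀ x ∈ U, ∀ y ∈ U, x ≠ y → G.Adj x y
  · exact ⟨u, hu, huQ, fun b hb c hc hbc _ _ => hcomplete b hb c hc hbc⟩
  -- The vertex a is chosen with Q ∩ U in its closed neighbourhood, so that vertices of U outside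
  -- that neighbourhood avoid Q. A member of Q in U with a non-neighbour in U will do; if there is
  -- none, Q ∩ U is joined to everything in U and any non-adjacent pair works.
  have hab : ∃ a ∈ U, (∀ q ∈ Q, q ∈ U → q = a ∨ G.Adj a q) ∧ ∃ b ∈ U, b ≠ a ∧ ¬ G.Adj a b := by
    by_cases hQU : ∃ a ∈ Q, a ∈ U ∧ ∃ b ∈ U, b ≠ a ∧ ¬ G.Adj a b
    · obtain ⟨a, haQ, haU, hb⟩ := hQU
      refine ⟨a, haU, fun q hq _ => ?_, hb⟩
      by_cases hqa : q = a
      · exact Or.inl hqa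
      · exact Or.inr (hQ a haQ q hq (Ne.symm hqa))
    · push Not at hQU hcomplete
      obtain ⟨a, ha, b, hb, hne, hnadj⟩ := hcomplete
      refine ⟨a, ha, fun q hq hqU => ?_, b, hb, hne.symm, hnadj⟩
      by_cases hqa : q = a
      · exact Or.inl hqa
      · exact Or.inr (hQU q hq hqU a ha (Ne.symm hqa)).symm
  obtain ⟨a, ha, hQa, b, hb, hba, hnab⟩ := hab
  let R : V → V → Prop := fun x y => G.Adj x y ∧ y ∈ U ∧ y ≠ a ∧ ¬ G.Adj a y
  let C : Set V := {c | Relation.ReflTransGen R b c}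
  have hCZ : ∀ c ∈ C, c ∈ U ∧ c ≠ a ∧ ¬ G.Adj a c := by
    intro c hc
    cases Relation.ReflTransGen.cases_tail hc with
    | inl h => exact h ▸ ⟨hb, hba, hnab⟩
    | inr h =>
      obtain ⟨_, _, h⟩ := h
      exact h.2
  have hCwalk : ∀ c ∈ C, ∃ p : G.Walk b c, ∀ z ∈ p.support, z ∈ C := by
    intro c hc
    induction hc with
    | refl =>
      refine ⟨.nil, fun z hz => ?_⟩
      rw [Walk.support_nil, List.mem_singleton] at hz
      exact hz ▸ Relation.ReflTransGen.refl
    | @tail c d hc hcd ih' =>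
      obtain ⟨p, hp⟩ := ih'
      refine ⟨p.concat hcd.1, fun z hz => ?_⟩
      rw [Walk.support_concat, List.mem_append, List.mem_singleton] at hz
      rcases hz with hz | rfl
      · exact hp z hz
      · exact Relation.ReflTransGen.tail hc hcd
  let B : Set V := {x | x ∈ U ∧ G.Adj a x ∧ ∃ c ∈ C, G.Adj x c}
  have hnbr : ∀ c ∈ C, ∀ x ∈ U, G.Adj c x → x ∈ C ∨ x ∈ B := by
    intro c hc x hx hcx
    by_cases hax : G.Adj a x
    · exact Or.inr ⟨hx, hax, c, hc, hcx.symm⟩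
    · refine Or.inl (Relation.ReflTransGen.tail hc ⟨hcx, hx, ?_, hax⟩)
      rintro rfl
      exact (hCZ c hc).2.2 hcx.symm
  have hB : ∀ x ∈ B, ∀ y ∈ B, x ≠ y → G.Adj x y := by
    rintro x ⟨-, hax, c, hc, hxc⟩ y ⟨-, hay, d, hd, hyd⟩ hxy
    obtain ⟨p, hp⟩ := hCwalk c hc
    obtain ⟨p', hp'⟩ := hCwalk d hd
    refine hG.adj_of_walk hax hay hxy (fun c hc => (hCZ c hc).2)
      (.cons hxc ((p.reverse.append p').concat hyd.symm)) fun z hz => ?_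
    rw [Walk.support_cons, Walk.support_concat, List.mem_cons, List.mem_append,
      List.mem_singleton, Walk.mem_support_append_iff, Walk.support_reverse,
      List.mem_reverse] at hz
    rcases hz with h | (h | h) | h
    · exact Or.inl h
    · exact Or.inr (Or.inr (hp z h))
    · exact Or.inr (Or.inr (hp' z h))
    · exact Or.inr (Or.inl h)
  have hss : U.filter (fun x => x ∈ C ∨ x ∈ B) ⊂ U := by
    refine Finset.filter_ssubset.2 ⟨a, ha, ?_⟩
    rintro (h | h)
    · exact (hCZ a h).2.1 rfl
    · exact G.irrefl h.2.1
  obtain ⟨v, hv, hvB, hsimp⟩ := ih _ hss B hB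
    ⟨b, Finset.mem_filter.2 ⟨hb, Or.inl .refl⟩, fun h => hnab h.2.1⟩
  rw [Finset.mem_filter] at hv
  have hvC : v ∈ C := hv.2.resolve_right hvB
  refine ⟨v, hv.1, fun hvQ => ?_, fun x hx y hy hxy hvx hvy => ?_⟩
  · rcases hQa v hvQ hv.1 with h | h
    · exact (hCZ v hvC).2.1 h
    · exact (hCZ v hvC).2.2 h
  · exact hsimp x (Finset.mem_coe.2 (Finset.mem_filter.2 ⟨hx, hnbr v hvC x hx hvx⟩)) y
      (Finset.mem_coe.2 (Finset.mem_filter.2 ⟨hy, hnbr v hvC y hy hvy⟩)) hxy hvx hvy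

theorem IsChordalGraph.exists_isSimplicialIn (hG : G.IsChordalGraph) (U : Finset V)
    (hU : U.Nonempty) : ∃ a ∈ U, G.IsSimplicialIn U a := by
  obtain ⟨u, hu⟩ := hU
  obtain ⟨a, ha, -, h⟩ := hG.exists_isSimplicialIn_notMem U ∅ (by simp) ⟨u, hu, by simp⟩
  exact ⟨a, ha, h⟩

end SimpleGraph

/-! ### Graphic arrangements of graphs with a simplicial elimination order. -/

section GraphicArrangement

variable {K : Type*} [Field K] {E : Type*} [AddCommGroup E] [Module K E]
  {W : Type*}

/-- The hyperplanes `φ a = φ b` for the edges `ab` of a graph within a set `U` of vertices. -/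
def graphicHyperplanes (G : SimpleGraph W) (φ : W → E →ₗ[K] K) (U : Set W) :
    Set (Submodule K E) :=
  {H | ∃ a ∈ U, ∃ b ∈ U, G.Adj a b ∧ H = LinearMap.ker (φ a - φ b)}

theorem graphicHyperplanes_mem_cases {G : SimpleGraph W} {φ : W → E →ₗ[K] K} {U : Set W} {a : W}
    {H : Submodule K E} (hH : H ∈ graphicHyperplanes G φ U)
    (hH' : H ∉ graphicHyperplanes G φ (U \ {a})) :
    ∃ b ∈ U, G.Adj a b ∧ H = LinearMap.ker (φ a - φ b) := by
  obtain ⟨c, hc, d, hd, hcd, rfl⟩ := hH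
  by_cases hca : c = a
  · exact ⟨d, hd, hca ▸ hcd, by rw [hca]⟩
  by_cases hda : d = a
  · refine ⟨c, hc, hda ▸ hcd.symm, ?_⟩
    rw [← hda, ← neg_sub (φ d), LinearMap.ker_neg]
  · exact absurd ⟨c, ⟨hc, hca⟩, d, ⟨hd, hda⟩, hcd, rfl⟩ hH'

variable [FiniteDimensional K E]

/-- The hypothesis `hφ` is affine independence of the forms: some evaluation separates each form
from all the others, on which it is constant. Two edges at the simplicial vertex `a` span a
triangle, and its third edge is the required hyperplane. -/
theorem isModularCoatomIn_graphicHyperplanes {G : SimpleGraph W} {φ : W → E →ₗ[K] K}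
    (hφ : ∀ a, ∃ (z : E) (c : K), φ a z ≠ c ∧ ∀ b ≠ a, φ b z = c) {U : Set W} {a : W}
    (ha : G.IsSimplicialIn U a) :
    IsModularCoatomIn (graphicHyperplanes G φ (U \ {a})) (graphicHyperplanes G φ U) where
  subset := by
    rintro H ⟨c, hc, d, hd, hcd, rfl⟩
    exact ⟨c, hc.1, d, hd.1, hcd, rfl⟩
  codim_eq_one := by
    rintro H ⟨c, hc, d, hd, hcd, rfl⟩
    refine LinearMap.codim_ker_eq_one _ fun h => ?_
    obtain ⟨z, k, hz, hz'⟩ := hφ c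
    have h1 := LinearMap.congr_fun h z
    rw [LinearMap.sub_apply, LinearMap.zero_apply, hz' d hcd.ne.symm, sub_eq_zero] at h1
    exact hz h1
  not_le := by
    intro H hH hH' hle
    obtain ⟨b, hb, hab, rfl⟩ := graphicHyperplanes_mem_cases hH hH'
    obtain ⟨z, k, hz, hz'⟩ := hφ a
    have hzmem : z ∈ sInf (graphicHyperplanes G φ (U \ {a})) := by
      rw [Submodule.mem_sInf]
      rintro H ⟨c, hc, d, hd, hcd, rfl⟩
      rw [LinearMap.mem_ker, LinearMap.sub_apply, hz' c hc.2, hz' d hd.2, sub_self]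
    have h1 := hle hzmem
    rw [LinearMap.mem_ker, LinearMap.sub_apply, hz' b hab.ne.symm, sub_eq_zero] at h1
    exact hz h1
  exists_line := by
    intro e he he' f hf hf' hef
    obtain ⟨b, hb, hab, rfl⟩ := graphicHyperplanes_mem_cases he he'
    obtain ⟨c, hc, hac, rfl⟩ := graphicHyperplanes_mem_cases hf hf'
    have hbc : b ≠ c := by
      rintro rfl
      exact hef rfl
    refine ⟨_, ⟨b, ⟨hb, hab.ne.symm⟩, c, ⟨hc, hac.ne.symm⟩, ha b hb c hc hbc hab hac, rfl⟩, ?_, ?_⟩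
    · rintro x ⟨hx, hy⟩
      simp only [SetLike.mem_coe, LinearMap.mem_ker, LinearMap.sub_apply] at hx hy ⊢
      linear_combination hy - hx
    · rintro x ⟨hx, hy⟩
      simp only [SetLike.mem_coe, LinearMap.mem_ker, LinearMap.sub_apply] at hx hy ⊢
      linear_combination hy + hx

theorem flatChain_graphicHyperplanes {G : SimpleGraph W} {φ : W → E →ₗ[K] K}
    (hφ : ∀ a, ∃ (z : E) (c : K), φ a z ≠ c ∧ ∀ b ≠ a, φ b z = c)
    (hG : ∀ U : Finset W, U.Nonempty → ∃ a ∈ U, G.IsSimplicialIn U a) (U : Finset W) :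
    ∀ h : (graphicHyperplanes G φ U).Finite,
      FlatChain (intersections h) (sInf (graphicHyperplanes G φ U)) ⊤
        (sInf (graphicHyperplanes G φ U)) := by
  classical
  induction U using Finset.strongInduction with
  | H U ih =>
    intro h
    rcases U.eq_empty_or_nonempty with rfl | hU
    · have h0 : sInf (graphicHyperplanes G φ ((∅ : Finset W) : Set W)) = ⊤ := by
        simp [graphicHyperplanes]
      rw [h0]
    · obtain ⟨a, ha, hsimp⟩ := hG U hU
      have hm := isModularCoatomIn_graphicHyperplanes hφ hsimp
      rw [← Finset.coe_erase] at hm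
      exact hm.flatChain_top (ih _ (Finset.erase_ssubset ha) (h.subset hm.subset))

end GraphicArrangement

/-! ### Frame arrangements, full cliques and the strengthened induction hypothesis. -/

namespace GainGraph

open Module

variable {V : Type u} {K : Type v} [Field K] {G : Subgroup Kˣ}

/-- The subspace of the vectors that vanish on `W`. -/
def vanishing (K : Type v) [Field K] (W : Set V) : Submodule K (V → K) where
  carrier := {x | ∀ a ∈ W, x a = 0}
  add_mem' hx hy a ha := by rw [Pi.add_apply, hx a ha, hy a ha, add_zero]
  zero_mem' _ _ := rfl
  smul_mem' c x hx a ha := by rw [Pi.smul_apply, hx a ha, smul_zero]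

theorem mem_vanishing {W : Set V} {x : V → K} : x ∈ vanishing K W ↔ ∀ a ∈ W, x a = 0 := Iff.rfl

theorem mem_ker_edgeForm {a b : V} {g : Kˣ} {x : V → K} :
    x ∈ LinearMap.ker (edgeForm a b g) ↔ x a = g * x b := by
  simp [edgeForm, LinearMap.mem_ker, sub_eq_zero]

theorem mem_ker_proj {a : V} {x : V → K} :
    x ∈ LinearMap.ker (LinearMap.proj a : (V → K) →ₗ[K] K) ↔ x a = 0 := by
  simp [LinearMap.mem_ker]

theorem ker_edgeForm_symm (a b : V) (g : Kˣ) :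
    LinearMap.ker (edgeForm (K := K) a b g) = LinearMap.ker (edgeForm b a g⁻¹) := by
  ext x
  rw [mem_ker_edgeForm, mem_ker_edgeForm, ← Units.inv_mul_eq_iff_eq_mul, eq_comm]

/-- The hyperplanes of the edges and loops of `Γ` within `U`. -/
def hyperplanesIn (Γ : GainGraph V G) (U : Set V) : Set (Submodule K (V → K)) :=
  {H | ∃ (a b : V) (g : G), a ∈ U ∧ b ∈ U ∧ Γ.Edge a b g ∧
      H = LinearMap.ker (edgeForm a b (g : Kˣ))} ∪
    {H | ∃ a, a ∈ U ∧ a ∈ Γ.Loops ∧ H = LinearMap.ker (LinearMap.proj a : (V → K) →ₗ[K] K)}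

/-- The vertices in `W` have loops and are joined by all possible edges. -/
structure IsFullClique (Γ : GainGraph V G) (W : Set V) : Prop where
  loop : ∀ a ∈ W, a ∈ Γ.Loops
  edge : ∀ a ∈ W, ∀ b ∈ W, a ≠ b → ∀ g, Γ.Edge a b g

section Basic

variable {Γ : GainGraph V G} {U W : Set V} {H : Submodule K (V → K)} {a b : V} {g : G}

theorem edge_mem_hyperplanesIn (ha : a ∈ U) (hb : b ∈ U) (h : Γ.Edge a b g) :
    LinearMap.ker (edgeForm a b (g : Kˣ)) ∈ Γ.hyperplanesIn U :=
  Or.inl ⟨a, b, g, ha, hb, h, rfl⟩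

theorem loop_mem_hyperplanesIn (ha : a ∈ U) (h : a ∈ Γ.Loops) :
    LinearMap.ker (LinearMap.proj a : (V → K) →ₗ[K] K) ∈ Γ.hyperplanesIn U :=
  Or.inr ⟨a, ha, h, rfl⟩

theorem edge_mem_frameHyperplanes (h : Γ.Edge a b g) :
    LinearMap.ker (edgeForm a b (g : Kˣ)) ∈ Γ.frameHyperplanes :=
  Or.inl ⟨a, b, g, h, rfl⟩

theorem loop_mem_frameHyperplanes (h : a ∈ Γ.Loops) :
    LinearMap.ker (LinearMap.proj a : (V → K) →ₗ[K] K) ∈ Γ.frameHyperplanes :=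
  Or.inr ⟨a, h, rfl⟩

theorem hyperplanesIn_subset (Γ : GainGraph V G) (U : Set V) :
    Γ.hyperplanesIn U ⊆ Γ.frameHyperplanes := by
  rintro H (⟨a, b, g, -, -, h, rfl⟩ | ⟨a, -, h, rfl⟩)
  · exact edge_mem_frameHyperplanes h
  · exact loop_mem_frameHyperplanes h

theorem mem_congr_of_mem_hyperplanesIn (hH : H ∈ Γ.hyperplanesIn U) {x y : V → K}
    (hxy : ∀ a ∈ U, x a = y a) : x ∈ H ↔ y ∈ H := by
  rcases hH with (⟨a, b, g, ha, hb, -, rfl⟩ | ⟨a, ha, -, rfl⟩)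
  · rw [mem_ker_edgeForm, mem_ker_edgeForm, hxy a ha, hxy b hb]
  · rw [mem_ker_proj, mem_ker_proj, hxy a ha]

theorem vanishing_le_of_mem_hyperplanesIn (hH : H ∈ Γ.hyperplanesIn U) : vanishing K U ≤ H :=
  fun _ hx => (mem_congr_of_mem_hyperplanesIn hH (y := 0) fun a ha => hx a ha).2 H.zero_mem

theorem vanishing_le_sInf_hyperplanesIn (Γ : GainGraph V G) (U : Set V) :
    vanishing K U ≤ sInf (Γ.hyperplanesIn U) :=
  le_sInf fun _ => vanishing_le_of_mem_hyperplanesIn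

/-- A hyperplane involving a coordinate outside `U` excludes the corresponding unit vector. Hence an
induced subgraph gives a localization of the arrangement. -/
theorem mem_hyperplanesIn_of_vanishing_le (hH : H ∈ Γ.frameHyperplanes)
    (hle : vanishing K U ≤ H) : H ∈ Γ.hyperplanesIn U := by
  classical
  have hsingle : ∀ c ∉ U, (Pi.single c 1 : V → K) ∈ H := by
    refine fun c hc => hle fun d hd => Pi.single_eq_of_ne ?_ _
    rintro rfl
    exact hc hd
  rcases hH with (⟨a, b, g, h, rfl⟩ | ⟨a, h, rfl⟩)
  · have hab : a ≠ b := by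
      rintro rfl
      exact Γ.irrefl a g h
    refine edge_mem_hyperplanesIn ?_ ?_ h
    · by_contra hc
      have := mem_ker_edgeForm.1 (hsingle a hc)
      simp [Pi.single_eq_of_ne hab.symm] at this
    · by_contra hc
      have := mem_ker_edgeForm.1 (hsingle b hc)
      simp [Pi.single_eq_of_ne hab, eq_comm] at this
  · refine loop_mem_hyperplanesIn ?_ h
    by_contra hc
    have := mem_ker_proj.1 (hsingle a hc)
    simp at this

theorem IsFullClique.subset (h : Γ.IsFullClique W) (hU : U ⊆ W) : Γ.IsFullClique U :=
  ⟨fun a ha => h.loop a (hU ha), fun a ha b hb => h.edge a (hU ha) b (hU hb)⟩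

theorem IsFullClique.sInf_hyperplanesIn_le (h : Γ.IsFullClique W) (hWU : W ⊆ U) :
    sInf (Γ.hyperplanesIn U) ≤ vanishing K W := fun _ hx a ha =>
  mem_ker_proj.1 (Submodule.mem_sInf.1 hx _ (loop_mem_hyperplanesIn (hWU ha) (h.loop a ha)))

end Basic

variable [Finite V] [Finite G] {Γ : GainGraph V G} {U V₁ V₂ W : Set V}

/-- The flats of the frame arrangement, as subspaces. -/
noncomputable abbrev flats (Γ : GainGraph V G) : Finset (Submodule K (V → K)) :=
  intersections Γ.finite_frameHyperplanes

/-- The arrangement of the part of `Γ` within `U` has divisional flags that pass through a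
complement of any given full clique. -/
def HasFlagsIn (Γ : GainGraph V G) (U : Set V) : Prop :=
  ∀ W ⊆ U, Γ.IsFullClique W → ∃ w ∈ Γ.flats, w ⊔ vanishing K W = ⊤ ∧
    w ⊓ vanishing K W = sInf (Γ.hyperplanesIn U) ∧
    FlatChain Γ.flats (sInf (Γ.hyperplanesIn U)) ⊤ w ∧
    FlatChain Γ.flats (sInf (Γ.hyperplanesIn U)) w (sInf (Γ.hyperplanesIn U))

/-- The frame arrangement of `Γ` has divisional flags that pass through a complement of any given
full clique. -/
def HasFlags (Γ : GainGraph V G) : Prop :=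
  ∀ W, Γ.IsFullClique W → ∃ w ∈ Γ.flats, w ⊔ vanishing K W = ⊤ ∧
    w ⊓ vanishing K W = sInf Γ.frameHyperplanes ∧
    FlatChain Γ.flats (sInf Γ.frameHyperplanes) ⊤ w ∧
    FlatChain Γ.flats (sInf Γ.frameHyperplanes) w (sInf Γ.frameHyperplanes)

/-- Restriction of vectors to `U` pulls the arrangement of the induced subgraph back to a
localization of the arrangement of Γ, and flags and complements are pulled back with it. -/
theorem HasFlags.hasFlagsIn (h : (Γ.induce U).HasFlags) : Γ.HasFlagsIn U := by
  intro W hWU hW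
  let π : (V → K) →ₗ[K] (U → K) := LinearMap.funLeft K K Subtype.val
  have hπ : Function.Surjective π :=
    LinearMap.funLeft_surjective_of_injective K K _ Subtype.val_injective
  have h1 : ∀ H ∈ (Γ.induce U).frameHyperplanes, H.comap π ∈ Γ.hyperplanesIn U := by
    rintro H (⟨a, b, g, hab, rfl⟩ | ⟨a, ha, rfl⟩)
    · exact edge_mem_hyperplanesIn a.2 b.2 hab
    · exact loop_mem_hyperplanesIn a.2 ha
  have h2 : ∀ H ∈ Γ.hyperplanesIn U, ∃ H' ∈ (Γ.induce U).frameHyperplanes, H'.comap π = H := by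
    rintro H (⟨a, b, g, ha, hb, hab, rfl⟩ | ⟨a, ha, hl, rfl⟩)
    · exact ⟨_, edge_mem_frameHyperplanes (a := (⟨a, ha⟩ : U)) (b := ⟨b, hb⟩) hab, rfl⟩
    · exact ⟨_, loop_mem_frameHyperplanes (a := (⟨a, ha⟩ : U)) hl, rfl⟩
  have hT : (sInf (Γ.induce U).frameHyperplanes).comap π = sInf (Γ.hyperplanesIn U) := by
    ext x
    simp only [Submodule.mem_comap, Submodule.mem_sInf]
    constructor
    · intro hx H hH
      obtain ⟨H', hH', rfl⟩ := h2 H hH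
      exact hx H' hH'
    · exact fun hx H hH => hx _ (h1 H hH)
  have hcl : (Γ.induce U).IsFullClique (Subtype.val ⁻¹' W) :=
    ⟨fun a ha => hW.loop a ha, fun a ha b hb hab =>
      hW.edge a ha b hb fun h => hab (Subtype.ext h)⟩
  have hv : (vanishing K (Subtype.val ⁻¹' W : Set U)).comap π = vanishing K W := by
    ext x
    exact ⟨fun hx a ha => hx ⟨a, hWU ha⟩ ha, fun hx a ha => hx a ha⟩
  obtain ⟨w, hw, hsup, hinf, hc1, hc2⟩ := h _ hcl
  have key : ∀ {P Q : Submodule K (U → K)}, P ∈ (Γ.induce U).flats →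
      FlatChain (Γ.induce U).flats (sInf (Γ.induce U).frameHyperplanes) P Q →
      FlatChain Γ.flats (sInf (Γ.hyperplanesIn U)) (P.comap π) (Q.comap π) := by
    intro P Q hP hc
    rw [← hT]
    refine FlatChain.comap π hπ (fun H hH => Γ.hyperplanesIn_subset U (h1 H hH))
      (fun H hH hle => h2 H ?_) hc hP
    rw [hT] at hle
    exact mem_hyperplanesIn_of_vanishing_le hH ((Γ.vanishing_le_sInf_hyperplanesIn U).trans hle)
  have hc1' := key top_mem_intersections hc1
  rw [Submodule.comap_top] at hc1'
  have hc2' := key hw hc2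
  rw [hT] at hc2'
  refine ⟨w.comap π, hc1'.mem top_mem_intersections, ?_, ?_, hc1', hc2'⟩
  · rw [eq_top_iff]
    intro x _
    have hx : π x ∈ w ⊔ vanishing K (Subtype.val ⁻¹' W : Set U) := by
      rw [hsup]
      trivial
    obtain ⟨a, ha, b, hb, hab⟩ := Submodule.mem_sup.1 hx
    obtain ⟨a, rfl⟩ := hπ a
    refine Submodule.mem_sup.2 ⟨a, ha, x - a, ?_, by abel⟩
    rw [← hv, Submodule.mem_comap, map_sub, ← hab, add_sub_cancel_left]
    exact hb
  · rw [← hv, ← Submodule.comap_inf, hinf, hT]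

/-- Full cliques are modular: a vector on a full clique extends to a flat if it satisfies the
equations of the flat within the clique. -/
theorem IsFullClique.exists_extension (hW : Γ.IsFullClique W) {F : Submodule K (V → K)}
    (hF : F ∈ Γ.flats) {x : V → K} (hx : ∀ H ∈ Γ.hyperplanesIn W, F ≤ H → x ∈ H) :
    ∃ y ∈ F, ∀ a ∈ W, y a = x a := by
  classical
  -- `rel a b g` says that F forces coordinate a to be g times the clique coordinate b. The
  -- extension y takes the forced values, and 0 where nothing is forced.
  let rel : V → V → G → Prop := fun a b g => b ∈ W ∧ ∀ z ∈ F, z a = ((g : Kˣ) : K) * z b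
  have hloop : ∀ b ∈ W, (∀ z ∈ F, z b = 0) → x b = 0 := fun b hb h =>
    mem_ker_proj.1 (hx _ (loop_mem_hyperplanesIn hb (hW.loop b hb))
      fun z hz => mem_ker_proj.2 (h z hz))
  -- Two forced values agree because the clique contains every possible relation: different clique
  -- vertices are compared by the edge of gain g⁻¹g', and two gains at one vertex force its loop
  -- equation.
  have huniq : ∀ {a b b' : V} {g g' : G}, rel a b g → rel a b' g' →
      ((g : Kˣ) : K) * x b = ((g' : Kˣ) : K) * x b' := by
    rintro a b b' g g' ⟨hb, h⟩ ⟨hb', h'⟩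
    by_cases hbb : b = b'
    · subst hbb
      by_cases hgg : g = g'
      · rw [hgg]
      · rw [hloop b hb fun z hz => ?_, mul_zero, mul_zero]
        have h0 : (((g : Kˣ) : K) - ((g' : Kˣ) : K)) * z b = 0 := by
          rw [sub_mul, ← h z hz, ← h' z hz, sub_self]
        refine (mul_eq_zero.1 h0).resolve_left fun h1 => hgg ?_
        exact Subtype.ext (Units.ext (sub_eq_zero.1 h1))
    · have hmem := hx _ (edge_mem_hyperplanesIn hb hb' (hW.edge b hb b' hb' hbb (g⁻¹ * g')))
        fun z hz => by
          rw [mem_ker_edgeForm, Subgroup.coe_mul, Subgroup.coe_inv, Units.val_mul, mul_assoc,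
            ← h' z hz, h z hz, Units.inv_mul_cancel_left]
      rw [mem_ker_edgeForm, Subgroup.coe_mul, Subgroup.coe_inv, Units.val_mul, mul_assoc] at hmem
      rw [hmem, Units.mul_inv_cancel_left]
  let y : V → K := fun a =>
    if h : ∃ p : V × G, rel a p.1 p.2 then ((h.choose.2 : Kˣ) : K) * x h.choose.1 else 0
  have hy : ∀ {a b : V} {g : G}, rel a b g → y a = ((g : Kˣ) : K) * x b := by
    intro a b g h
    have hex : ∃ p : V × G, rel a p.1 p.2 := ⟨(b, g), h⟩
    simp only [y, dif_pos hex]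
    exact huniq hex.choose_spec h
  have hy0 : ∀ {a : V}, (¬ ∃ p : V × G, rel a p.1 p.2) → y a = 0 := fun h => dif_neg h
  refine ⟨y, mem_intersections_iff.1 hF y ?_, fun a ha => ?_⟩
  · rintro H (⟨a, b, k, hab, rfl⟩ | ⟨a, ha, rfl⟩) hFH
    · have hk : ∀ z ∈ F, z a = ((k : Kˣ) : K) * z b := fun z hz => mem_ker_edgeForm.1 (hFH hz)
      rw [mem_ker_edgeForm]
      by_cases hb : ∃ p : V × G, rel b p.1 p.2
      · obtain ⟨⟨c, g⟩, hc, h⟩ := hb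
        have hrel : rel a c (k * g) := ⟨hc, fun z hz => by
          rw [hk z hz, h z hz, Subgroup.coe_mul, Units.val_mul, mul_assoc]⟩
        rw [hy hrel, hy ⟨hc, h⟩, Subgroup.coe_mul, Units.val_mul, mul_assoc]
      · have ha : ¬ ∃ p : V × G, rel a p.1 p.2 := by
          rintro ⟨⟨c, g⟩, hc, h⟩
          refine hb ⟨(c, k⁻¹ * g), hc, fun z hz => ?_⟩
          rw [Subgroup.coe_mul, Subgroup.coe_inv, Units.val_mul, mul_assoc, ← h z hz, hk z hz,
            Units.inv_mul_cancel_left]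
        rw [hy0 ha, hy0 hb, mul_zero]
    · rw [mem_ker_proj]
      by_cases hex : ∃ p : V × G, rel a p.1 p.2
      · obtain ⟨⟨c, g⟩, hc, h⟩ := hex
        rw [hy ⟨hc, h⟩, hloop c hc fun z hz => ?_, mul_zero]
        have h0 := h z hz
        rw [mem_ker_proj.1 (hFH hz)] at h0
        exact (mul_eq_zero.1 h0.symm).resolve_left (Units.ne_zero _)
      · exact hy0 hex
  · rw [hy (b := a) (g := 1) ⟨ha, fun z _ => by simp⟩]
    simp

/-! ### Gluing along a full clique. -/

/-- `Γ` is the union of its parts within `V₁` and `V₂`, whose intersection is a full clique. -/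
structure IsGlued (Γ : GainGraph V G) (V₁ V₂ : Set V) : Prop where
  union_eq : V₁ ∪ V₂ = Set.univ
  edge : ∀ a b g, Γ.Edge a b g → (a ∈ V₁ ∧ b ∈ V₁) ∨ (a ∈ V₂ ∧ b ∈ V₂)
  clique : Γ.IsFullClique (V₁ ∩ V₂)

namespace IsGlued

omit [Finite V] [Finite G] in
theorem symm (h : Γ.IsGlued V₁ V₂) : Γ.IsGlued V₂ V₁ :=
  ⟨by rw [Set.union_comm, h.union_eq], fun a b g hab => (h.edge a b g hab).symm,
    by rw [Set.inter_comm]; exact h.clique⟩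

omit [Finite V] [Finite G] in
theorem mem_or_mem (h : Γ.IsGlued V₁ V₂) {H : Submodule K (V → K)}
    (hH : H ∈ Γ.frameHyperplanes) : H ∈ Γ.hyperplanesIn V₁ ∨ H ∈ Γ.hyperplanesIn V₂ := by
  rcases hH with (⟨a, b, g, hab, rfl⟩ | ⟨a, ha, rfl⟩)
  · rcases h.edge a b g hab with h | h
    · exact Or.inl (edge_mem_hyperplanesIn h.1 h.2 hab)
    · exact Or.inr (edge_mem_hyperplanesIn h.1 h.2 hab)
  · have hV : a ∈ V₁ ∪ V₂ := h.union_eq ▸ Set.mem_univ a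
    rcases hV with hV | hV
    · exact Or.inl (loop_mem_hyperplanesIn hV ha)
    · exact Or.inr (loop_mem_hyperplanesIn hV ha)

omit [Finite V] [Finite G] in
theorem inf_eq (h : Γ.IsGlued V₁ V₂) :
    sInf (Γ.hyperplanesIn V₁) ⊓ sInf (Γ.hyperplanesIn V₂) = sInf Γ.frameHyperplanes := by
  rw [← sInf_union]
  congr 1
  exact subset_antisymm (Set.union_subset (Γ.hyperplanesIn_subset _) (Γ.hyperplanesIn_subset _))
    fun H hH => h.mem_or_mem hH

omit [Finite V] [Finite G] in
-- The loops of the clique force both centres to vanish on it. Conversely, a vector vanishing there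
-- splits into a part supported off `V₁` and a part supported off `V₂`.
theorem sup_eq (h : Γ.IsGlued V₁ V₂) :
    sInf (Γ.hyperplanesIn V₁) ⊔ sInf (Γ.hyperplanesIn V₂) = vanishing K (V₁ ∩ V₂) := by
  classical
  refine le_antisymm (sup_le (h.clique.sInf_hyperplanesIn_le Set.inter_subset_left)
    (h.clique.sInf_hyperplanesIn_le Set.inter_subset_right)) fun x hx => ?_
  refine Submodule.mem_sup.2 ⟨fun a => if a ∈ V₁ then 0 else x a,
    Γ.vanishing_le_sInf_hyperplanesIn V₁ fun a ha => if_pos ha,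
    fun a => if a ∈ V₁ then x a else 0,
    Γ.vanishing_le_sInf_hyperplanesIn V₂ fun a ha => ?_, ?_⟩
  · by_cases ha' : a ∈ V₁
    · simp only [if_pos ha']
      exact hx a ⟨ha', ha⟩
    · exact if_neg ha'
  · ext a
    by_cases ha : a ∈ V₁ <;> simp [ha]

theorem isModularFlat (h : Γ.IsGlued V₁ V₂) :
    IsModularFlat Γ.flats (sInf (Γ.hyperplanesIn V₁)) := by
  classical
  refine ⟨sInf_mem_intersections (Γ.hyperplanesIn_subset V₁), fun F hF => ?_⟩
  rw [mem_intersections_iff]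
  intro x hx
  have hx₁ : ∀ H ∈ Γ.hyperplanesIn V₁, F ≤ H → x ∈ H := fun H hH hFH =>
    hx H (Γ.hyperplanesIn_subset V₁ hH) (sup_le hFH (sInf_le hH))
  -- F₂ keeps only the equations of F within V₂. Extending x from the clique to a vector of F₂ and
  -- using x itself on V₁ gives a vector of F that agrees with x on V₁.
  let F₂ : Submodule K (V → K) := sInf {H ∈ Γ.hyperplanesIn V₂ | F ≤ H}
  have hF₂ : F₂ ∈ Γ.flats := sInf_mem_intersections fun H hH => Γ.hyperplanesIn_subset V₂ hH.1
  have hFF₂ : F ≤ F₂ := le_sInf fun H hH => hH.2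
  have hsub : Γ.hyperplanesIn (V₁ ∩ V₂) ⊆ Γ.hyperplanesIn V₁ := by
    rintro H (⟨a, b, g, ha, hb, hab, rfl⟩ | ⟨a, ha, hl, rfl⟩)
    · exact edge_mem_hyperplanesIn ha.1 hb.1 hab
    · exact loop_mem_hyperplanesIn ha.1 hl
  obtain ⟨y, hyF, hyx⟩ := h.clique.exists_extension hF₂ (x := x) fun H hH hle =>
    hx₁ H (hsub hH) (hFF₂.trans hle)
  let z : V → K := fun a => if a ∈ V₁ then x a else y a
  have hzx : ∀ a ∈ V₁, z a = x a := fun a ha => if_pos ha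
  have hzy : ∀ a ∈ V₂, z a = y a := by
    intro a ha
    by_cases ha' : a ∈ V₁
    · rw [hzx a ha', hyx a ⟨ha', ha⟩]
    · exact if_neg ha'
  have hzF : z ∈ F := by
    refine mem_intersections_iff.1 hF z fun H hH hFH => ?_
    rcases h.mem_or_mem hH with hH | hH
    · exact (mem_congr_of_mem_hyperplanesIn hH hzx).2 (hx₁ H hH hFH)
    · exact (mem_congr_of_mem_hyperplanesIn hH hzy).2 (Submodule.mem_sInf.1 hyF H ⟨hH, hFH⟩)
  refine Submodule.mem_sup.2 ⟨z, hzF, x - z, Γ.vanishing_le_sInf_hyperplanesIn V₁ fun a ha => ?_,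
    by abel⟩
  rw [Pi.sub_apply, hzx a ha, sub_self]

theorem sup_inf_sup_le (h : Γ.IsGlued V₁ V₂) {Y : Submodule K (V → K)} (hY : Y ∈ Γ.flats) :
    (Y ⊔ sInf (Γ.hyperplanesIn V₁)) ⊓ (Y ⊔ sInf (Γ.hyperplanesIn V₂)) ≤ Y := by
  refine le_trans (le_sInf ?_) (mem_intersections_iff_sInf_le.1 hY)
  rintro H ⟨hH, hYH⟩
  rcases h.mem_or_mem hH with hH | hH
  · exact inf_le_left.trans (sup_le hYH (sInf_le hH))
  · exact inf_le_right.trans (sup_le hYH (sInf_le hH))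

omit [Finite V] [Finite G] in
theorem sup_eq_top (h : Γ.IsGlued V₁ V₂) {Y : Submodule K (V → K)}
    (hle : sInf (Γ.hyperplanesIn V₂) ≤ Y) (htop : Y ⊔ vanishing K (V₁ ∩ V₂) = ⊤) :
    Y ⊔ sInf (Γ.hyperplanesIn V₁) = ⊤ := by
  rw [← h.sup_eq, sup_left_comm, sup_eq_left.2 hle, sup_comm] at htop
  exact htop

/-- Above `w`, every flat joins with the clique flat and with the flat of `V₁` to `⊤`. Two of the
four factors in Brylawski's formula are then constant, and divisibility for `V₂` transfers to Γ
after cancelling the clique polynomial. -/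
theorem flatChain (h : Γ.IsGlued V₁ V₂) {w : Submodule K (V → K)}
    (hle : sInf (Γ.hyperplanesIn V₂) ≤ w) (htop : w ⊔ vanishing K (V₁ ∩ V₂) = ⊤)
    (hc : FlatChain Γ.flats (sInf (Γ.hyperplanesIn V₂)) ⊤ w) :
    FlatChain Γ.flats (sInf Γ.frameHyperplanes) ⊤ w := by
  have hpoly : ∀ Y ∈ Γ.flats, w ≤ Y →
      flatPoly Γ.flats (sInf Γ.frameHyperplanes) Y * flatPoly Γ.flats (vanishing K (V₁ ∩ V₂)) ⊤ =
        flatPoly Γ.flats (sInf (Γ.hyperplanesIn V₁)) ⊤ *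
          flatPoly Γ.flats (sInf (Γ.hyperplanesIn V₂)) Y := by
    intro Y hY hwY
    have h1 := flatPoly_mul_flatPoly_sup inf_mem_intersections h.isModularFlat
      h.symm.isModularFlat (fun Y hY => h.sup_inf_sup_le hY) Y hY
      (h.inf_eq.le.trans (sInf_le_of_mem_intersections hY))
    have hYtop : Y ⊔ vanishing K (V₁ ∩ V₂) = ⊤ :=
      top_le_iff.1 (htop.ge.trans (sup_le_sup_right hwY _))
    rwa [h.inf_eq, h.sup_eq, hYtop, h.sup_eq_top (hle.trans hwY) hYtop,
      sup_eq_left.2 (hle.trans hwY)] at h1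
  refine FlatChain.map id hc top_mem_intersections fun A hA B hwB hAB => ?_
  refine ⟨hAB.le, sInf_le_of_mem_intersections hAB.mem, hAB.mem, hAB.finrank_eq, ?_⟩
  have h1 := mul_dvd_mul_left (flatPoly Γ.flats (sInf (Γ.hyperplanesIn V₁)) ⊤) hAB.dvd
  rw [← hpoly A hA (hwB.trans hAB.le), ← hpoly B hAB.mem hwB] at h1
  exact (mul_dvd_mul_iff_right (flatPoly_ne_zero _ _ _)).1 h1

/-- The flag runs from `⊤` to w₂, then to w₂ ⊓ w₁, then to the centre. Since w₂ complements the
modular flat of `V₁`, intersecting with w₂ preserves the polynomials of the flag of `V₁`. -/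
theorem exists_flag (h : Γ.IsGlued V₁ V₂) (h₁ : Γ.HasFlagsIn V₁) (h₂ : Γ.HasFlagsIn V₂)
    (hWV : W ⊆ V₁) (hW : Γ.IsFullClique W) :
    ∃ w ∈ Γ.flats, w ⊔ vanishing K W = ⊤ ∧ w ⊓ vanishing K W = sInf Γ.frameHyperplanes ∧
      FlatChain Γ.flats (sInf Γ.frameHyperplanes) ⊤ w ∧
      FlatChain Γ.flats (sInf Γ.frameHyperplanes) w (sInf Γ.frameHyperplanes) := by
  obtain ⟨w₁, hw₁, hsup₁, hinf₁, hc₁, hd₁⟩ := h₁ W hWV hW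
  obtain ⟨w₂, hw₂, hsup₂, hinf₂, hc₂, -⟩ := h₂ _ Set.inter_subset_right h.clique
  have hle₁ : sInf (Γ.hyperplanesIn V₁) ≤ w₁ := hinf₁ ▸ inf_le_left
  have hle₂ : sInf (Γ.hyperplanesIn V₂) ≤ w₂ := hinf₂ ▸ inf_le_left
  have htop : w₂ ⊔ sInf (Γ.hyperplanesIn V₁) = ⊤ := h.sup_eq_top hle₂ hsup₂
  have hbot : w₂ ⊓ sInf (Γ.hyperplanesIn V₁) = sInf Γ.frameHyperplanes := by
    rw [← h.inf_eq, ← hinf₂, inf_left_comm,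
      inf_eq_left.2 (h.clique.sInf_hyperplanesIn_le Set.inter_subset_left)]
  have hpoly : ∀ Y ∈ Γ.flats, sInf (Γ.hyperplanesIn V₁) ≤ Y →
      w₂ ⊓ Y ⊔ sInf (Γ.hyperplanesIn V₁) = Y ∧
      flatPoly Γ.flats (sInf Γ.frameHyperplanes) (w₂ ⊓ Y) =
        flatPoly Γ.flats (sInf (Γ.hyperplanesIn V₁)) Y := by
    intro Y hY hle
    have h1 : w₂ ⊓ Y ⊔ sInf (Γ.hyperplanesIn V₁) = Y := by
      rw [sup_comm, ← sup_inf_assoc_of_le w₂ hle, sup_comm, htop, top_inf_eq]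
    refine ⟨h1, ?_⟩
    rw [flatPoly_eq_of_inf_eq inf_mem_intersections h.isModularFlat
      (inf_mem_intersections _ hw₂ _ hY), h1]
    rw [inf_assoc, inf_eq_right.2 hle, hbot]
  have hchain : ∀ {P Q}, P ∈ Γ.flats → sInf (Γ.hyperplanesIn V₁) ≤ Q →
      FlatChain Γ.flats (sInf (Γ.hyperplanesIn V₁)) P Q →
      FlatChain Γ.flats (sInf Γ.frameHyperplanes) (w₂ ⊓ P) (w₂ ⊓ Q) := by
    intro P Q hP hQ hc
    refine FlatChain.map (fun Y => w₂ ⊓ Y) hc hP fun A hA B hQB hAB => ?_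
    have hleB := hQ.trans hQB
    have hleA := hleB.trans hAB.le
    have hmem : w₂ ⊓ B ∈ Γ.flats := inf_mem_intersections _ hw₂ _ hAB.mem
    refine ⟨inf_le_inf_left _ hAB.le, sInf_le_of_mem_intersections hmem, hmem, ?_, ?_⟩
    · have e1 := Submodule.finrank_sup_add_finrank_inf_eq (w₂ ⊓ A) (sInf (Γ.hyperplanesIn V₁))
      have e2 := Submodule.finrank_sup_add_finrank_inf_eq (w₂ ⊓ B) (sInf (Γ.hyperplanesIn V₁))
      rw [(hpoly A hA hleA).1, inf_assoc, inf_eq_right.2 hleA] at e1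
      rw [(hpoly B hAB.mem hleB).1, inf_assoc, inf_eq_right.2 hleB] at e2
      have := hAB.finrank_eq
      change finrank K ↥(w₂ ⊓ A) = finrank K ↥(w₂ ⊓ B) + 1
      omega
    · rw [(hpoly A hA hleA).2, (hpoly B hAB.mem hleB).2]
      exact hAB.dvd
  have hc' := hchain top_mem_intersections hle₁ hc₁
  have hd' := hchain hw₁ le_rfl hd₁
  rw [inf_top_eq] at hc'
  rw [hbot] at hd'
  refine ⟨w₂ ⊓ w₁, inf_mem_intersections _ hw₂ _ hw₁, ?_, ?_,
    (h.flatChain hle₂ hsup₂ hc₂).trans hc', hd'⟩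
  · refine top_le_iff.1 ?_
    calc ⊤ = w₁ ⊔ vanishing K W := hsup₁.symm
      _ ≤ w₂ ⊓ w₁ ⊔ sInf (Γ.hyperplanesIn V₁) ⊔ vanishing K W :=
        sup_le_sup_right (hpoly w₁ hw₁ hle₁).1.ge _
      _ ≤ w₂ ⊓ w₁ ⊔ vanishing K W := by
        rw [sup_assoc]
        exact sup_le_sup_left (sup_le (hinf₁ ▸ inf_le_right) le_rfl) _
  · rw [inf_assoc, hinf₁, hbot]

/-- No edge leaves both parts, so a full clique lies within one of them, and the situation is
symmetric. -/
theorem hasFlags (h : Γ.IsGlued V₁ V₂) (h₁ : Γ.HasFlagsIn V₁) (h₂ : Γ.HasFlagsIn V₂) :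
    Γ.HasFlags := by
  intro W hW
  by_cases hWV : W ⊆ V₁
  · exact h.exists_flag h₁ h₂ hWV hW
  refine h.symm.exists_flag h₂ h₁ (fun b hb => ?_) hW
  obtain ⟨a, ha, haV⟩ := Set.not_subset.1 hWV
  have hV : ∀ c, c ∈ V₁ ∨ c ∈ V₂ := fun c => (h.union_eq ▸ Set.mem_univ c : c ∈ V₁ ∪ V₂)
  by_cases hab : a = b
  · exact hab ▸ (hV a).resolve_left haV
  rcases h.edge a b 1 (hW.edge a ha b hb hab 1) with h | h
  · exact absurd h.1 haV
  · exact h.2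

end IsGlued

end GainGraph

namespace GainGraph

open Module

variable {V : Type u} {K : Type v} [Field K] {G : Subgroup Kˣ} [Finite V] [Finite G]
  {Γ : GainGraph V G}

/-! ### Adding a bias-simplicial vertex. -/

section BiasSimplicial

variable {v : V} {W : Set V}

omit [Finite V] [Finite G] in
theorem frameHyperplanes_mem_cases {H : Submodule K (V → K)} (hH : H ∈ Γ.frameHyperplanes)
    (hH' : H ∉ Γ.hyperplanesIn {v}ᶜ) :
    (∃ (a : V) (g : G), Γ.Edge a v g ∧ H = LinearMap.ker (edgeForm a v (g : Kˣ))) ∨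
      (v ∈ Γ.Loops ∧ H = LinearMap.ker (LinearMap.proj v : (V → K) →ₗ[K] K)) := by
  rcases hH with (⟨a, b, g, hab, rfl⟩ | ⟨a, ha, rfl⟩)
  · by_cases hbv : b = v
    · exact Or.inl ⟨a, g, hbv ▸ hab, by rw [hbv]⟩
    by_cases hav : a = v
    · refine Or.inl ⟨b, g⁻¹, hav ▸ Γ.symm hab, ?_⟩
      rw [hav, ker_edgeForm_symm, Subgroup.coe_inv]
    · exact absurd (edge_mem_hyperplanesIn hav hbv hab) hH'
  · by_cases hav : a = v
    · exact Or.inr ⟨hav ▸ ha, by rw [hav]⟩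
    · exact absurd (loop_mem_hyperplanesIn hav ha) hH'

omit [Finite V] [Finite G] in
theorem Edge.ne {a b : V} {g : G} (h : Γ.Edge a b g) : a ≠ b := by
  rintro rfl
  exact Γ.irrefl a g h

omit [Finite V] [Finite G] in
theorem single_mem_sInf_hyperplanesIn [DecidableEq V] (c : K) :
    (Pi.single v c : V → K) ∈ sInf (Γ.hyperplanesIn {v}ᶜ) :=
  Γ.vanishing_le_sInf_hyperplanesIn _ fun _ ha => Pi.single_eq_of_ne ha _

omit [Finite V] [Finite G] in
theorem edge_notMem_hyperplanesIn {a : V} {g : G} (h : Γ.Edge a v g) :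
    LinearMap.ker (edgeForm a v (g : Kˣ)) ∉ Γ.hyperplanesIn {v}ᶜ := by
  classical
  intro hmem
  have := mem_ker_edgeForm.1 (Submodule.mem_sInf.1 (single_mem_sInf_hyperplanesIn 1) _ hmem)
  simp [Pi.single_eq_of_ne (Edge.ne h), eq_comm] at this

omit [Finite V] [Finite G] in
theorem loop_notMem_hyperplanesIn (Γ : GainGraph V G) (v : V) :
    LinearMap.ker (LinearMap.proj v : (V → K) →ₗ[K] K) ∉ Γ.hyperplanesIn {v}ᶜ := by
  classical
  intro hmem
  have := mem_ker_proj.1 (Submodule.mem_sInf.1 (single_mem_sInf_hyperplanesIn 1) _ hmem)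
  simp at this

namespace IsBiasSimplicial

/-- The three conditions on `v` supply the third hyperplane through the intersection of two
hyperplanes at `v`: an edge for two distinct neighbours, a loop for two parallel edges, and a loop
for an edge together with the loop at `v`. -/
theorem isModularCoatomIn (hv : Γ.IsBiasSimplicial v) :
    IsModularCoatomIn (Γ.hyperplanesIn {v}ᶜ) Γ.frameHyperplanes where
  subset := Γ.hyperplanesIn_subset _
  codim_eq_one := Γ.frameArrangement.codim_eq_one
  not_le := fun _ he he' hle => he' <|
    mem_hyperplanesIn_of_vanishing_le he ((Γ.vanishing_le_sInf_hyperplanesIn _).trans hle)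
  exists_line := by
    intro e he he' f hf hf' hef
    rcases frameHyperplanes_mem_cases he he' with ⟨a, g, ha, rfl⟩ | ⟨hl, rfl⟩ <;>
    rcases frameHyperplanes_mem_cases hf hf' with ⟨b, k, hb, rfl⟩ | ⟨hl', rfl⟩
    · by_cases hab : a = b
      · subst hab
        have hgk : g ≠ k := by
          rintro rfl
          exact hef rfl
        refine ⟨_, loop_mem_hyperplanesIn (Edge.ne ha) (hv.parallel ha hb hgk), ?_, ?_⟩
        · rintro x ⟨hx, hy⟩
          rw [SetLike.mem_coe, mem_ker_edgeForm] at hx hy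
          have h0 : (((g : Kˣ) : K) - ((k : Kˣ) : K)) * x v = 0 := by
            rw [sub_mul, ← hx, ← hy, sub_self]
          have hxv := (mul_eq_zero.1 h0).resolve_left fun h1 =>
            hgk (Subtype.ext (Units.ext (sub_eq_zero.1 h1)))
          rw [mem_ker_proj, hx, hxv, mul_zero]
        · rintro x ⟨hx, hy⟩
          rw [SetLike.mem_coe, mem_ker_edgeForm] at hx
          rw [SetLike.mem_coe, mem_ker_proj] at hy
          rw [hy] at hx
          rw [mem_ker_edgeForm, hy, (mul_eq_zero.1 hx.symm).resolve_left (Units.ne_zero _),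
            mul_zero]
      · refine ⟨_, edge_mem_hyperplanesIn (Edge.ne ha) (Edge.ne hb)
          (hv.triangle hab ha (Γ.symm hb)), ?_, ?_⟩
        · rintro x ⟨hx, hy⟩
          rw [SetLike.mem_coe, mem_ker_edgeForm] at hx hy
          rw [mem_ker_edgeForm, hx, hy, Subgroup.coe_mul, Subgroup.coe_inv, Units.val_mul,
            mul_assoc, Units.inv_mul_cancel_left]
        · rintro x ⟨hx, hy⟩
          rw [SetLike.mem_coe, mem_ker_edgeForm] at hx hy
          rw [Subgroup.coe_mul, Subgroup.coe_inv, Units.val_mul, mul_assoc, hx] at hy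
          rw [mem_ker_edgeForm, mul_left_cancel₀ (Units.ne_zero _) hy, Units.mul_inv_cancel_left]
    · refine ⟨_, loop_mem_hyperplanesIn (Edge.ne ha) (hv.loop ha hl'), ?_, ?_⟩
      · rintro x ⟨hx, hy⟩
        rw [SetLike.mem_coe, mem_ker_edgeForm] at hx
        rw [SetLike.mem_coe, mem_ker_proj] at hy
        rw [mem_ker_proj, hx, hy, mul_zero]
      · rintro x ⟨hx, hy⟩
        rw [SetLike.mem_coe, mem_ker_edgeForm] at hx
        rw [SetLike.mem_coe, mem_ker_proj] at hy
        rw [hy] at hx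
        rw [mem_ker_proj]
        exact (mul_eq_zero.1 hx.symm).resolve_left (Units.ne_zero _)
    · refine ⟨_, loop_mem_hyperplanesIn (Edge.ne hb) (hv.loop hb hl), ?_, ?_⟩
      · rintro x ⟨hy, hx⟩
        rw [SetLike.mem_coe, mem_ker_edgeForm] at hx
        rw [SetLike.mem_coe, mem_ker_proj] at hy
        rw [mem_ker_proj, hx, hy, mul_zero]
      · rintro x ⟨hx, hy⟩
        rw [SetLike.mem_coe, mem_ker_proj] at hx hy
        rw [mem_ker_edgeForm, hx, hy, mul_zero]
    · exact absurd rfl hef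

/-- The clique already lies in Γ \ v. Its complement there, cut by any hyperplane at `v`, is a
complement in Γ. -/
theorem exists_flag_of_notMem (hv : Γ.IsBiasSimplicial v) (h : Γ.HasFlagsIn {v}ᶜ)
    (hW : Γ.IsFullClique W) (hvW : v ∉ W) :
    ∃ w ∈ Γ.flats, w ⊔ vanishing K W = ⊤ ∧ w ⊓ vanishing K W = sInf Γ.frameHyperplanes ∧
      FlatChain Γ.flats (sInf Γ.frameHyperplanes) ⊤ w ∧
      FlatChain Γ.flats (sInf Γ.frameHyperplanes) w (sInf Γ.frameHyperplanes) := by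
  have hm := hv.isModularCoatomIn
  obtain ⟨w, hw, hsup, hinf, hc, hd⟩ := h W (Set.subset_compl_singleton_iff.2 hvW) hW
  by_cases hex : ∃ e ∈ Γ.frameHyperplanes, e ∉ Γ.hyperplanesIn {v}ᶜ
  · obtain ⟨e, he, he'⟩ := hex
    have hle : sInf (Γ.hyperplanesIn {v}ᶜ) ≤ w := hinf ▸ inf_le_left
    have hc' := hm.flatChain_inf he he' hc top_mem_intersections hle
    have hd' := hm.flatChain_inf he he' hd hw le_rfl
    rw [hm.inf_eq he he'] at hd'
    refine ⟨w ⊓ e, inf_mem_intersections _ hw _ (mem_intersections_of_mem he), ?_, ?_,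
      hc'.head (hm.flatStep_inf he he' top_mem_intersections le_top), hd'⟩
    · have h1 : w ⊓ e ⊔ sInf (Γ.hyperplanesIn {v}ᶜ) = w := by
        rw [inf_comm, sup_comm, ← sup_inf_assoc_of_le e hle, sup_comm,
          hm.sup_eq_top he he' le_rfl, top_inf_eq]
      refine top_le_iff.1 ?_
      calc ⊤ = w ⊔ vanishing K W := hsup.symm
        _ ≤ w ⊓ e ⊔ sInf (Γ.hyperplanesIn {v}ᶜ) ⊔ vanishing K W := sup_le_sup_right h1.ge _
        _ ≤ w ⊓ e ⊔ vanishing K W := by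
          rw [sup_assoc]
          exact sup_le_sup_left (sup_le (hinf ▸ inf_le_right) le_rfl) _
    · rw [inf_right_comm, hinf, hm.inf_eq he he']
  · push Not at hex
    have heq : Γ.hyperplanesIn {v}ᶜ = Γ.frameHyperplanes :=
      subset_antisymm (Γ.hyperplanesIn_subset _) hex
    rw [heq] at hinf hc hd
    exact ⟨w, hw, hsup, hinf, hc, hd⟩

/-- A neighbour `a` outside `W` can replace `v`: bias-simpliciality makes (W \ {v}) ∪ {a} a full
clique of Γ \ v. The hyperplane x_a = g x_v identifies the two vertices, so it cuts the flat w of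
the new clique to the flat required for `W`. -/
theorem exists_flag_of_edge (hv : Γ.IsBiasSimplicial v) (h : Γ.HasFlagsIn {v}ᶜ)
    (hW : Γ.IsFullClique W) (hvW : v ∈ W) {a : V} {g : G} (ha : Γ.Edge a v g) (haW : a ∉ W) :
    ∃ w ∈ Γ.flats, w ⊔ vanishing K W = ⊤ ∧ w ⊓ vanishing K W = sInf Γ.frameHyperplanes ∧
      FlatChain Γ.flats (sInf Γ.frameHyperplanes) ⊤ w ∧
      FlatChain Γ.flats (sInf Γ.frameHyperplanes) w (sInf Γ.frameHyperplanes) := by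
  classical
  have hm := hv.isModularCoatomIn
  have hab : ∀ b ∈ W \ {v}, ∀ k, Γ.Edge a b k := by
    intro b hb k
    have hne : a ≠ b := by
      rintro rfl
      exact haW hb.1
    have := hv.triangle hne ha (hW.edge v hvW b hb.1 (Ne.symm hb.2) (g⁻¹ * k))
    rwa [mul_inv_cancel_left] at this
  have hW' : Γ.IsFullClique (insert a (W \ {v})) := by
    refine ⟨?_, ?_⟩
    · rintro b (rfl | hb)
      · exact hv.loop ha (hW.loop v hvW)
      · exact hW.loop b hb.1
    · rintro b (rfl | hb) c (rfl | hc) hbc k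
      · exact absurd rfl hbc
      · exact hab c hc k
      · have := Γ.symm (hab b hb k⁻¹)
        rwa [inv_inv] at this
      · exact hW.edge b hb.1 c hc.1 hbc k
  have hsub : insert a (W \ {v}) ⊆ {v}ᶜ := by
    rintro b (rfl | hb)
    · exact Edge.ne ha
    · exact hb.2
  obtain ⟨w, hw, hsup, hinf, hc, hd⟩ := h _ hsub hW'
  have hle : sInf (Γ.hyperplanesIn {v}ᶜ) ≤ w := hinf ▸ inf_le_left
  have he := edge_mem_frameHyperplanes ha
  have he' := edge_notMem_hyperplanesIn ha
  set e := LinearMap.ker (edgeForm (K := K) a v (g : Kˣ)) with hedef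
  have hc' := hm.flatChain_inf he he' hc top_mem_intersections hle
  have hd' := hm.flatChain_inf he he' hd hw le_rfl
  rw [hm.inf_eq he he'] at hd'
  have hmem : w ⊓ e ∈ Γ.flats := inf_mem_intersections _ hw _ (mem_intersections_of_mem he)
  refine ⟨w ⊓ e, hmem, ?_, ?_,
    hc'.head (hm.flatStep_inf he he' top_mem_intersections le_top), hd'⟩
  · refine top_le_iff.1 fun y _ => ?_
    -- The value at a is prescribed so that correcting coordinate v to y v lands in e. The
    -- correction stays in w, which contains every vector supported at v.
    have hy : Function.update y a ((g : Kˣ) * y v) ∈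
        w ⊔ vanishing K (insert a (W \ {v})) := by
      rw [hsup]
      trivial
    obtain ⟨p, hp, q, hq, hpq⟩ := Submodule.mem_sup.1 hy
    have hpa : p a = (g : Kˣ) * y v := by
      have h1 := congrFun hpq a
      rwa [Pi.add_apply, hq a (Set.mem_insert _ _), add_zero, Function.update_self] at h1
    have hpb : ∀ b ∈ W \ {v}, p b = y b := by
      intro b hb
      have h1 := congrFun hpq b
      rwa [Pi.add_apply, hq b (Set.mem_insert_of_mem _ hb), add_zero, Function.update_of_ne] at h1
      rintro rfl
      exact haW hb.1
    let r : V → K := p + Pi.single v (y v - p v)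
    have hrv : r v = y v := by simp [r]
    have hrb : ∀ b, b ≠ v → r b = p b := fun b hb => by simp [r, Pi.single_eq_of_ne hb]
    refine Submodule.mem_sup.2 ⟨r, ⟨w.add_mem hp (hle (single_mem_sInf_hyperplanesIn _)), ?_⟩,
      y - r, fun b hb => ?_, by abel⟩
    · rw [SetLike.mem_coe, mem_ker_edgeForm, hrv, hrb a (Edge.ne ha), hpa]
    · by_cases hbv : b = v
      · rw [Pi.sub_apply, hbv, hrv, sub_self]
      · rw [Pi.sub_apply, hrb b hbv, hpb b ⟨hb, hbv⟩, sub_self]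
  · refine le_antisymm (fun x hx => ?_)
      (le_inf (sInf_le_of_mem_intersections hmem) fun x hx b hb =>
        mem_ker_proj.1 (Submodule.mem_sInf.1 hx _ (loop_mem_frameHyperplanes (hW.loop b hb))))
    obtain ⟨⟨hxw, hxe⟩, hxW⟩ := hx
    rw [← hm.inf_eq he he', ← hinf]
    refine ⟨⟨hxw, ?_⟩, hxe⟩
    rintro b (rfl | hb)
    · rw [SetLike.mem_coe, mem_ker_edgeForm] at hxe
      rw [hxe, hxW v hvW, mul_zero]
    · exact hxW b hb.1

/-- Now Γ is glued from the clique `W` and Γ \ v along W \ {v}. The flat w for W \ {v} serves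
unchanged, since coordinate `v` is free on it. The upper half of the flag survives by gluing, and
the lower half starts with the extra step x_v = 0. -/
theorem exists_flag_of_forall_mem (hv : Γ.IsBiasSimplicial v) (h : Γ.HasFlagsIn {v}ᶜ)
    (hW : Γ.IsFullClique W) (hvW : v ∈ W) (hadj : ∀ a g, Γ.Edge a v g → a ∈ W) :
    ∃ w ∈ Γ.flats, w ⊔ vanishing K W = ⊤ ∧ w ⊓ vanishing K W = sInf Γ.frameHyperplanes ∧
      FlatChain Γ.flats (sInf Γ.frameHyperplanes) ⊤ w ∧
      FlatChain Γ.flats (sInf Γ.frameHyperplanes) w (sInf Γ.frameHyperplanes) := by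
  classical
  have hm := hv.isModularCoatomIn
  have hglue : Γ.IsGlued W {v}ᶜ := by
    refine ⟨?_, fun a b g hab => ?_, hW.subset Set.inter_subset_left⟩
    · rw [Set.eq_univ_iff_forall]
      intro a
      by_cases hav : a = v
      · exact Or.inl (hav ▸ hvW)
      · exact Or.inr hav
    · by_cases hbv : b = v
      · subst hbv
        exact Or.inl ⟨hadj a g hab, hvW⟩
      by_cases hav : a = v
      · subst hav
        exact Or.inl ⟨hvW, hadj b _ (Γ.symm hab)⟩
      · exact Or.inr ⟨hav, hbv⟩
  obtain ⟨w, hw, hsup, hinf, hc, hd⟩ := h _ Set.inter_subset_right hglue.clique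
  have hle : sInf (Γ.hyperplanesIn {v}ᶜ) ≤ w := hinf ▸ inf_le_left
  have he := loop_mem_frameHyperplanes (hW.loop v hvW)
  have he' := Γ.loop_notMem_hyperplanesIn v
  set e := LinearMap.ker (LinearMap.proj v : (V → K) →ₗ[K] K) with hedef
  have hd' := hm.flatChain_inf he he' hd hw le_rfl
  rw [hm.inf_eq he he'] at hd'
  refine ⟨w, hw, ?_, ?_, hglue.flatChain hle hsup hc, hd'.head (hm.flatStep_inf he he' hw hle)⟩
  · refine top_le_iff.1 fun y _ => ?_
    have hy : y ∈ w ⊔ vanishing K (W ∩ {v}ᶜ) := by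
      rw [hsup]
      trivial
    obtain ⟨p, hp, q, hq, hpq⟩ := Submodule.mem_sup.1 hy
    let r : V → K := p + Pi.single v (y v - p v)
    refine Submodule.mem_sup.2 ⟨r, w.add_mem hp (hle (single_mem_sInf_hyperplanesIn _)),
      y - r, fun b hb => ?_, by abel⟩
    by_cases hbv : b = v
    · subst hbv
      simp [r]
    · have h1 := congrFun hpq b
      rw [Pi.add_apply, hq b ⟨hb, hbv⟩, add_zero] at h1
      simp [r, Pi.single_eq_of_ne hbv, h1]
  · rw [← hm.inf_eq he he', ← hinf, inf_assoc]
    congr 1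
    ext x
    rw [Submodule.mem_inf, mem_ker_proj, mem_vanishing, mem_vanishing]
    refine ⟨fun hx => ⟨fun b hb => hx b hb.1, hx v hvW⟩, fun hx b hb => ?_⟩
    by_cases hbv : b = v
    · exact hbv ▸ hx.2
    · exact hx.1 b ⟨hb, hbv⟩

theorem hasFlags (hv : Γ.IsBiasSimplicial v) (h : Γ.HasFlagsIn {v}ᶜ) : Γ.HasFlags := by
  intro W hW
  by_cases hvW : v ∈ W
  · by_cases hex : ∃ a g, Γ.Edge a v g ∧ a ∉ W
    · obtain ⟨a, g, ha, haW⟩ := hex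
      exact hv.exists_flag_of_edge h hW hvW ha haW
    · push Not at hex
      exact hv.exists_flag_of_forall_mem h hW hvW hex
  · exact hv.exists_flag_of_notMem h hW hvW

end IsBiasSimplicial

end BiasSimplicial

/-! ### Loopless base cases. -/

section Loopless

theorem hasFlags_of_flatChain (hloops : Γ.Loops = ∅)
    (h : FlatChain Γ.flats (sInf Γ.frameHyperplanes) ⊤ (sInf Γ.frameHyperplanes)) :
    Γ.HasFlags := by
  intro W hW
  obtain rfl : W = ∅ := Set.eq_empty_of_forall_notMem fun a ha => by
    have := hW.loop a ha
    rw [hloops] at this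
    exact this
  have hv : vanishing K (∅ : Set V) = ⊤ := top_le_iff.1 fun x _ a ha => absurd ha (by simp)
  rw [hv]
  exact ⟨_, sInf_mem_intersections subset_rfl, sup_top_eq _, inf_top_eq _, h, .refl⟩

theorem hasFlags_of_isEmpty [IsEmpty V] (Γ : GainGraph V G) : Γ.HasFlags := by
  refine hasFlags_of_flatChain (Set.eq_empty_of_isEmpty _) ?_
  have : sInf Γ.frameHyperplanes = ⊤ := Subsingleton.elim _ _
  rw [this]

theorem hasFlags_of_isIso_completeTwo (h : Γ.IsIso (complete 2 (⊤ : Subgroup G))) :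
    Γ.HasFlags := by
  obtain ⟨σ, hσ, hl⟩ := h
  have hloops : Γ.Loops = ∅ := Set.eq_empty_of_forall_notMem fun a ha => (hl a).1 ha
  refine hasFlags_of_flatChain hloops ?_
  set p := σ.symm 0 with hp
  set q := σ.symm 1 with hq
  have hpq : ∀ a, a = p ∨ a = q := by
    intro a
    rw [hp, hq, Equiv.eq_symm_apply, Equiv.eq_symm_apply]
    omega
  have hne : p ≠ q := fun h => by simp [hp, hq] at h
  have hform : ∀ H ∈ Γ.frameHyperplanes, ∃ g : G, H = LinearMap.ker (edgeForm p q (g : Kˣ)) := by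
    rintro H (⟨a, b, g, hab, rfl⟩ | ⟨a, ha, rfl⟩)
    · rcases hpq a with rfl | rfl <;> rcases hpq b with rfl | rfl
      · exact absurd hab (Γ.irrefl _ _)
      · exact ⟨g, rfl⟩
      · exact ⟨g⁻¹, by rw [ker_edgeForm_symm, Subgroup.coe_inv]⟩
      · exact absurd hab (Γ.irrefl _ _)
    · rw [hloops] at ha
      exact absurd ha (by simp)
  have hedge : Γ.Edge p q 1 := (hσ _ _ _).2 ⟨by simp [hp, hq], trivial⟩
  set e₀ := LinearMap.ker (edgeForm (K := K) p q ((1 : G) : Kˣ)) with he₀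
  have he₀mem : e₀ ∈ Γ.frameHyperplanes := edge_mem_frameHyperplanes hedge
  have hcodim := Γ.frameArrangement.codim_eq_one
  have hbot : ∀ e ∈ Γ.frameHyperplanes, ∀ f ∈ Γ.frameHyperplanes, e ≠ f → e ⊓ f = ⊥ := by
    intro e he f hf hef
    obtain ⟨g, rfl⟩ := hform e he
    obtain ⟨k, rfl⟩ := hform f hf
    refine eq_bot_iff.2 ?_
    rintro x ⟨hx, hy⟩
    rw [SetLike.mem_coe, mem_ker_edgeForm] at hx hy
    have hgk : g ≠ k := by
      rintro rfl
      exact hef rfl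
    have h0 : (((g : Kˣ) : K) - ((k : Kˣ) : K)) * x q = 0 := by
      rw [sub_mul, ← hx, ← hy, sub_self]
    have hxq := (mul_eq_zero.1 h0).resolve_left fun h1 =>
      hgk (Subtype.ext (Units.ext (sub_eq_zero.1 h1)))
    rw [Submodule.mem_bot]
    ext a
    rcases hpq a with rfl | rfl
    · rw [hx, hxq, mul_zero, Pi.zero_apply]
    · rw [hxq, Pi.zero_apply]
  -- Distinct hyperplanes meet in zero, so ∅, {e₀}, and the whole arrangement form a chain of
  -- modular coatoms.
  have hm₀ : IsModularCoatomIn ∅ {e₀} := by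
    refine ⟨Set.empty_subset _, fun H hH => hcodim H (hH ▸ he₀mem), fun e he _ hle => ?_,
      fun e he _ f hf _ hef => absurd (he.trans hf.symm) hef⟩
    rw [sInf_empty, top_le_iff] at hle
    exact (Submodule.isCoatom_of_codim_eq_one (hcodim e (he ▸ he₀mem))).1 hle
  have hm : IsModularCoatomIn {e₀} Γ.frameHyperplanes := by
    refine ⟨Set.singleton_subset_iff.2 he₀mem, hcodim, fun e he he' hle => he' ?_,
      fun e he he' f hf _ hef => ⟨e₀, rfl, ?_, ?_⟩⟩
    · rw [sInf_singleton] at hle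
      exact ((Submodule.isCoatom_of_codim_eq_one (hcodim _ he₀mem)).le_iff.1 hle).resolve_left
        (Submodule.isCoatom_of_codim_eq_one (hcodim _ he)).1
    · rw [hbot e he f hf hef]
      exact bot_le
    · rw [hbot e he e₀ he₀mem he']
      exact bot_le
  refine hm.flatChain_top (h' := Set.finite_singleton _) (hm₀.flatChain_top
    (h' := Set.finite_empty) ?_)
  rw [sInf_empty]

/-- A loopless gain graph whose frame arrangement is graphic, for a graph with a perfect
elimination order. -/
theorem hasFlags_of_graphic {W : Type*} [Finite W] (hloops : Γ.Loops = ∅) {H : SimpleGraph W}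
    {φ : W → (V → K) →ₗ[K] K}
    (hφ : ∀ a, ∃ (z : V → K) (c : K), φ a z ≠ c ∧ ∀ b ≠ a, φ b z = c)
    (hH : ∀ U : Finset W, U.Nonempty → ∃ a ∈ U, H.IsSimplicialIn U a)
    (h₁ : ∀ a b g, Γ.Edge a b g → ∃ c d, H.Adj c d ∧
      LinearMap.ker (edgeForm a b (g : Kˣ)) = LinearMap.ker (φ c - φ d))
    (h₂ : ∀ c d, H.Adj c d → ∃ a b g, Γ.Edge a b g ∧
      LinearMap.ker (edgeForm a b (g : Kˣ)) = LinearMap.ker (φ c - φ d)) : Γ.HasFlags := by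
  have := Fintype.ofFinite W
  have heq : Γ.frameHyperplanes = graphicHyperplanes H φ ((Finset.univ : Finset W) : Set W) := by
    ext P
    constructor
    · rintro (⟨a, b, g, hab, rfl⟩ | ⟨a, ha, rfl⟩)
      · obtain ⟨c, d, hcd, hker⟩ := h₁ a b g hab
        exact ⟨c, by simp, d, by simp, hcd, hker⟩
      · rw [hloops] at ha
        exact absurd ha (by simp)
    · rintro ⟨c, -, d, -, hcd, rfl⟩
      obtain ⟨a, b, g, hab, hker⟩ := h₂ c d hcd
      rw [← hker]
      exact edge_mem_frameHyperplanes hab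
  refine hasFlags_of_flatChain hloops ?_
  have key : ∀ h : Γ.frameHyperplanes.Finite,
      FlatChain (intersections h) (sInf Γ.frameHyperplanes) ⊤ (sInf Γ.frameHyperplanes) := by
    rw [heq]
    exact flatChain_graphicHyperplanes hφ hH _
  exact key _

/-- A loopless gain graph with trivial gains and chordal underlying graph. -/
theorem hasFlags_of_positive (hloops : Γ.Loops = ∅) (hgain : ∀ a b g, Γ.Edge a b g → g = 1)
    (hH : ∀ U : Finset V, U.Nonempty → ∃ a ∈ U, Γ.positivePart.IsSimplicialIn U a) :
    Γ.HasFlags := by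
  classical
  refine hasFlags_of_graphic hloops (H := Γ.positivePart) (φ := fun a => LinearMap.proj a)
    (fun a => ⟨Pi.single a 1, 0, by simp, fun b hb => by simp [Pi.single_eq_of_ne hb]⟩) hH
    (fun a b g hab => ⟨a, b, ?_, ?_⟩) (fun a b hab => ⟨a, b, 1, hab, ?_⟩)
  · have := hgain a b g hab
    subst this
    exact hab
  · have := hgain a b g hab
    subst this
    simp [edgeForm]
  · simp [edgeForm]

omit [Finite V] [Finite G] in
theorem val_eq_of_mem_signSubgroup {g : G} (hg : (g : Kˣ) ∈ signSubgroup K) :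
    ((g : Kˣ) : K) = 1 ∨ ((g : Kˣ) : K) = -1 := by
  rcases hg with h | h
  · exact Or.inl (by rw [h, Units.val_one])
  · exact Or.inr (by rw [h, Units.val_neg, Units.val_one])

omit [Finite V] [Finite G] in
theorem eq_one_of_mem_signSubgroup (h2 : (2 : K) = 0) {g : G} (hg : (g : Kˣ) ∈ signSubgroup K) :
    g = 1 := by
  refine Subtype.ext (Units.ext ?_)
  rw [Subgroup.coe_one, Units.val_one]
  rcases val_eq_of_mem_signSubgroup hg with h | h
  · exact h
  · rw [h]
    linear_combination -h2

theorem hasFlags_of_isIso_signedCompleteThree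
    (hG : signSubgroup K ≤ G) (h : Γ.IsIso (complete 3 ((signSubgroup K).subgroupOf G))) :
    Γ.HasFlags := by
  classical
  obtain ⟨σ, hσ, hl⟩ := h
  have hloops : Γ.Loops = ∅ := Set.eq_empty_of_forall_notMem fun a ha => (hl a).1 ha
  have hedge : ∀ a b (g : G), Γ.Edge a b g ↔ a ≠ b ∧ (g : Kˣ) ∈ signSubgroup K := by
    intro a b g
    rw [hσ]
    exact and_congr_left' σ.injective.ne_iff
  -- In characteristic two the signs coincide and the graph is a positive triangle.
  by_cases h2 : (2 : K) = 0
  · refine hasFlags_of_positive hloops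
      (fun a b g hab => eq_one_of_mem_signSubgroup h2 ((hedge a b g).1 hab).2) fun U hU => ?_
    obtain ⟨a, ha⟩ := hU
    exact ⟨a, ha, fun b _ c _ hbc _ _ => (hedge b c 1).2 ⟨hbc, (signSubgroup K).one_mem⟩⟩
  let _ := Fintype.ofFinite V
  have hcard : Fintype.card V = 3 := by rw [Fintype.card_congr σ, Fintype.card_fin]
  let s : (V → K) →ₗ[K] K := ∑ a : V, LinearMap.proj a
  have hs : ∀ x, s x = ∑ a, x a := fun x => by simp [s]
  -- The coincidence D₃ = A₃: the differences of the four forms 0 and s - x_k are, up to sign, all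
  -- x_a - x_b and x_a + x_b, so the arrangement is that of the complete graph on four vertices.
  let φ : Option V → (V → K) →ₗ[K] K := fun o => o.elim 0 fun k => s - LinearMap.proj k
  have hnone : φ none = 0 := rfl
  have hsome : ∀ k, φ (some k) = s - LinearMap.proj k := fun _ => rfl
  have hthird : ∀ a b : V, a ≠ b → ∃ k, a ≠ k ∧ b ≠ k := by
    intro a b hab
    have : ({a, b} : Finset V) ≠ Finset.univ := fun h => by
      have := congrArg Finset.card h
      rw [Finset.card_pair hab, Finset.card_univ, hcard] at this
      omega
    obtain ⟨k, hk⟩ := not_forall.1 fun h => this (Finset.eq_univ_iff_forall.2 h)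
    simp only [Finset.mem_insert, Finset.mem_singleton, not_or] at hk
    exact ⟨k, Ne.symm hk.1, Ne.symm hk.2⟩
  have hpair : ∀ k : V, ∃ a b, a ≠ b ∧ a ≠ k ∧ b ≠ k := by
    intro k
    have : Nontrivial V := Fintype.one_lt_card_iff_nontrivial.1 (by omega)
    obtain ⟨a, ha⟩ := exists_ne k
    obtain ⟨b, hb1, hb2⟩ := hthird a k ha
    exact ⟨a, b, hb1, ha, hb2.symm⟩
  have hsum : ∀ {a b k : V}, a ≠ b → a ≠ k → b ≠ k → ∀ x, s x = x a + x b + x k := by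
    intro a b k hab hak hbk x
    have huniv : ({a, b, k} : Finset V) = Finset.univ :=
      Finset.eq_univ_of_card _ (by rw [Finset.card_eq_three.2 ⟨a, b, k, hab, hak, hbk, rfl⟩, hcard])
    rw [hs, ← huniv, Finset.sum_insert (by simp [hab, hak]), Finset.sum_pair hbk, add_assoc]
  have hpos : ∀ (a b : V) {g : G}, ((g : Kˣ) : K) = 1 →
      LinearMap.ker (edgeForm a b (g : Kˣ)) = LinearMap.ker (φ (some b) - φ (some a)) := by
    intro a b g hg
    ext x
    rw [mem_ker_edgeForm, hg, one_mul, hsome, hsome, sub_sub_sub_cancel_left, LinearMap.mem_ker,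
      LinearMap.sub_apply, sub_eq_zero]
    rfl
  have hneg : ∀ {a b k : V} {g : G}, a ≠ b → a ≠ k → b ≠ k → ((g : Kˣ) : K) = -1 →
      LinearMap.ker (edgeForm a b (g : Kˣ)) = LinearMap.ker (φ (some k) - φ none) := by
    intro a b k g hab hak hbk hg
    ext x
    rw [mem_ker_edgeForm, hg, hsome, hnone, sub_zero, LinearMap.mem_ker, LinearMap.sub_apply,
      hsum hab hak hbk, LinearMap.proj_apply, add_sub_cancel_right, neg_one_mul,
      eq_neg_iff_add_eq_zero]
  refine hasFlags_of_graphic hloops (H := ⊤) (φ := φ) ?_ ?_ ?_ ?_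
  -- The all-ones vector separates the zero form (0 against 3 - 1 = 2). Changing its kth entry to -1
  -- gives s = 1 and separates s - x_k (2 against 0).
  · rintro (_ | k)
    · refine ⟨fun _ => 1, 2, ?_, ?_⟩
      · rw [hnone]
        exact fun h => h2 h.symm
      · rintro (_ | k) hk
        · exact absurd rfl hk
        · rw [hsome, LinearMap.sub_apply, hs]
          simp [hcard]
          norm_num
    · obtain ⟨a, b, hab, hak, hbk⟩ := hpair k
      refine ⟨Function.update (fun _ => 1) k (-1), 0, ?_, ?_⟩
      · rw [hsome, LinearMap.sub_apply, hsum hab hak hbk]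
        simp only [LinearMap.proj_apply, Function.update_self, Function.update_of_ne hak,
          Function.update_of_ne hbk]
        intro h
        apply h2
        linear_combination h
      · rintro (_ | l) hl
        · rw [hnone]
          rfl
        · have hlk : l ≠ k := fun h => hl (by rw [h])
          rw [hsome, LinearMap.sub_apply, hsum hab hak hbk]
          simp only [LinearMap.proj_apply, Function.update_self, Function.update_of_ne hak,
            Function.update_of_ne hbk, Function.update_of_ne hlk]
          ring
  · rintro U ⟨a, ha⟩
    exact ⟨a, ha, fun b _ c _ hbc _ _ => hbc⟩
  · intro a b g hab
    obtain ⟨hne, hg⟩ := (hedge a b g).1 hab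
    rcases val_eq_of_mem_signSubgroup hg with hg | hg
    · exact ⟨some b, some a, by simpa using hne.symm, hpos a b hg⟩
    · obtain ⟨k, hak, hbk⟩ := hthird a b hne
      exact ⟨some k, none, by simp, hneg hne hak hbk hg⟩
  · have hm1 : (-1 : Kˣ) ∈ signSubgroup K := Or.inr rfl
    rintro (_ | k) (_ | l) hkl
    · exact absurd rfl hkl
    · obtain ⟨a, b, hab, hal, hbl⟩ := hpair l
      refine ⟨a, b, ⟨-1, hG hm1⟩, (hedge _ _ _).2 ⟨hab, hm1⟩, ?_⟩
      rw [hneg hab hal hbl (by simp), ← neg_sub, LinearMap.ker_neg]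
    · obtain ⟨a, b, hab, hak, hbk⟩ := hpair k
      exact ⟨a, b, ⟨-1, hG hm1⟩, (hedge _ _ _).2 ⟨hab, hm1⟩, hneg hab hak hbk (by simp)⟩
    · refine ⟨l, k, 1, (hedge _ _ _).2 ⟨fun h => hkl (by rw [h]), (signSubgroup K).one_mem⟩, ?_⟩
      exact hpos l k (by simp)

theorem IsChordalWithNegativeStar.hasFlags {hG : signSubgroup K ≤ G}
    (h : Γ.IsChordalWithNegativeStar hG) : Γ.HasFlags := by
  classical
  by_cases h2 : (2 : K) = 0
  · exact hasFlags_of_positive h.loopless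
      (fun a b g hab => eq_one_of_mem_signSubgroup h2 (h.gain_mem a b g hab))
      h.chordal.exists_isSimplicialIn
  obtain ⟨c, S, hcS, hstar, hclique⟩ := h.star
  -- The negative star is absorbed by a new vertex carrying the form -x_c and joined to S, as x_a +
  -- x_c is the difference of x_a and -x_c. Its neighbourhood S is a clique, so it can be eliminated
  -- first, leaving the chordal positive graph.
  let H : SimpleGraph (Option V) :=
    { Adj := fun x y => match x, y with
        | some a, some b => Γ.Edge a b 1
        | some a, none => a ∈ S
        | none, some b => b ∈ S
        | none, none => False
      symm := ⟨by
        rintro (_ | a) (_ | b) hab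
        · exact hab
        · exact hab
        · exact hab
        · exact Γ.positivePart.symm.symm _ _ hab⟩
      loopless := ⟨by
        rintro (_ | a) ha
        · exact ha
        · exact Γ.irrefl a 1 ha⟩ }
  let φ : Option V → (V → K) →ₗ[K] K := fun o =>
    o.elim (-LinearMap.proj c) fun a => LinearMap.proj a
  have hnone : φ none = -LinearMap.proj c := rfl
  have hsome : ∀ a, φ (some a) = LinearMap.proj a := fun _ => rfl
  have hpos : ∀ (a b : V) {g : G}, ((g : Kˣ) : K) = 1 →
      LinearMap.ker (edgeForm a b (g : Kˣ)) = LinearMap.ker (φ (some a) - φ (some b)) := by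
    intro a b g hg
    rw [edgeForm, hg, one_smul, hsome, hsome]
  have hneg : ∀ (a : V) {g : Kˣ}, (g : K) = -1 →
      LinearMap.ker (edgeForm a c g) = LinearMap.ker (φ (some a) - φ none) := by
    intro a g hg
    ext x
    rw [mem_ker_edgeForm, hg, neg_one_mul, hsome, hnone, LinearMap.mem_ker, LinearMap.sub_apply,
      LinearMap.neg_apply, sub_eq_zero]
    rfl
  refine hasFlags_of_graphic h.loopless (H := H) (φ := φ) ?_ ?_ ?_ ?_
  · rintro (_ | a)
    · refine ⟨fun _ => 1, 1, ?_, ?_⟩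
      · rw [hnone]
        intro h
        apply h2
        simp only [LinearMap.neg_apply, LinearMap.proj_apply] at h
        linear_combination -h
      · rintro (_ | b) hb
        · exact absurd rfl hb
        · rfl
    -- A unit vector separates x_a unless a = c, because -x_c also sees that coordinate. For a = c
    -- the vector with -1 at c and 1 elsewhere works: all other forms, including -x_c, take the
    -- value 1.
    · by_cases hac : a = c
      · subst hac
        refine ⟨Function.update (fun _ => 1) a (-1), 1, ?_, ?_⟩
        · rw [hsome, LinearMap.proj_apply, Function.update_self]
          intro h
          apply h2
          linear_combination -h
        · rintro (_ | b) hb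
          · rw [hnone]
            simp
          · rw [hsome, LinearMap.proj_apply, Function.update_of_ne]
            rintro rfl
            exact hb rfl
      · refine ⟨Pi.single a 1, 0, by simp [hsome], ?_⟩
        rintro (_ | b) hb
        · rw [hnone]
          simp [Pi.single_eq_of_ne (Ne.symm hac)]
        · rw [hsome, LinearMap.proj_apply, Pi.single_eq_of_ne]
          rintro rfl
          exact hb rfl
  · intro U hU
    by_cases hn : none ∈ U
    · refine ⟨none, hn, ?_⟩
      rintro (_ | b) _ (_ | d) _ hbd hb hd
      · exact absurd rfl hbd
      · exact hd
      · exact hb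
      · exact hclique b hb d hd fun h => hbd (by rw [h])
    · have hU' : (Finset.eraseNone U).Nonempty := by
        obtain ⟨_ | a, ha⟩ := hU
        · exact absurd ha hn
        · exact ⟨a, Finset.mem_eraseNone.2 ha⟩
      obtain ⟨a, ha, hsimp⟩ := h.chordal.exists_isSimplicialIn _ hU'
      refine ⟨some a, Finset.mem_eraseNone.1 ha, ?_⟩
      rintro (_ | b) hb (_ | d) hd hbd hab had
      · exact absurd rfl hbd
      · exact absurd hb hn
      · exact absurd hd hn
      · exact hsimp b (by simpa using hb) d (by simpa using hd) (fun h => hbd (by rw [h])) hab had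
  · intro a b g hab
    rcases h.gain_mem a b g hab with hg | hg
    · obtain rfl : g = 1 := Subtype.ext hg
      exact ⟨some a, some b, hab, hpos a b (by simp)⟩
    · obtain rfl : g = ⟨-1, hG (Or.inr rfl)⟩ := Subtype.ext hg
      rcases (hstar a b).1 hab with ⟨rfl, hb⟩ | ⟨rfl, ha⟩
      · refine ⟨some b, none, hb, ?_⟩
        rw [ker_edgeForm_symm]
        exact hneg b (by simp)
      · exact ⟨some a, none, ha, hneg a (by simp)⟩
  · rintro (_ | a) (_ | b) hab
    · exact absurd hab id
    · refine ⟨b, c, ⟨-1, hG (Or.inr rfl)⟩, (hstar b c).2 (Or.inr ⟨rfl, hab⟩), ?_⟩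
      rw [hneg b (by simp), ← neg_sub, LinearMap.ker_neg]
    · exact ⟨a, c, ⟨-1, hG (Or.inr rfl)⟩, (hstar a c).2 (Or.inr ⟨rfl, hab⟩), hneg a (by simp)⟩
    · exact ⟨a, b, 1, hab, hpos a b (by simp)⟩

end Loopless

/-! ### Induction over the class and conclusion. -/

omit [Finite V] [Finite G] in
theorem isFullClique_of_isIso {W : Set V} {n : ℕ}
    (h : (Γ.induce W).IsIso (completeWithLoops n G)) : Γ.IsFullClique W := by
  obtain ⟨σ, hσ, hl⟩ := h
  refine ⟨fun a ha => (hl ⟨a, ha⟩).2 trivial, fun a ha b hb hab g =>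
    (hσ ⟨a, ha⟩ ⟨b, hb⟩ g).2 fun h => hab ?_⟩
  exact congrArg Subtype.val (σ.injective h)

end GainGraph

theorem FrameClass.hasFlags {K : Type v} [Field K] {G : Subgroup Kˣ} [Finite G]
    {V : Type u} [Finite V] {Γ : GainGraph V G} (hΓ : FrameClass G Γ) : Γ.HasFlags := by
  induction hΓ with
  | null Γ => exact Γ.hasFlags_of_isEmpty
  | completeTwo Γ h => exact GainGraph.hasFlags_of_isIso_completeTwo h
  | signedCompleteThree hG Γ h => exact GainGraph.hasFlags_of_isIso_signedCompleteThree hG h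
  | chordalWithNegativeStar hG Γ h => exact h.hasFlags
  | biasSimplicial Γ v hv _ ih => exact hv.hasFlags ih.hasFlagsIn
  | glue Γ V₁ V₂ n hV _ _ hE hn ih₁ ih₂ =>
    exact GainGraph.IsGlued.hasFlags ⟨hV, hE, GainGraph.isFullClique_of_isIso hn⟩ ih₁.hasFlagsIn
      ih₂.hasFlagsIn

theorem mainTheorem3 {K : Type v} [Field K] (G : Subgroup Kˣ) [Finite G]
    {V : Type u} [Finite V] (Γ : GainGraph V G) (hΓ : FrameClass G Γ) :
    Γ.frameArrangement.IsDivisionallyFree := by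
  obtain ⟨w, -, -, -, hc, hd⟩ := hΓ.hasFlags ∅ ⟨by simp, by simp⟩
  exact Γ.frameArrangement.isDivisionallyFree_of_flatChain (hc.trans hd)
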